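/- Let $\mathbb{K}$ be an algebraically closed field of characteristic zero. For an affine variety $X$ over $\mathbb{K}$ (reduced, not necessarily irreducible) with coordinate ring $\mathbb{K}[X]$, a smooth point $x\in X$ is called flexible if the tangent space $T_xX$ is spanned by the tangent vectors at $x$ to the orbits of $x$ under regular actions $\mathbb{G}_a\times X\to X$ of the additive group $\mathbb{G}_a=(\mathbb{K},+)$; the variety $X$ is called flexible if all its smooth points are flexible, and factorial if $\mathbb{K}[X]$ is a unique factorization domain. Theorem 3.1. Let $Y$ be a flexible affine variety over $\mathbb{K}$ and let $f\in\mathbb{K}[Y]$ be a non-constant regular function. Let $\mathrm{Susp}(Y,f)$ be the suspension over $Y$, i.e. the hypersurface given in $\mathbb{A}^2\times Y$ by the equation $uv=f$, where $u,v$ are the coordinates on $\mathbb{A}^2$. Then $\mathrm{Susp}(Y,f)$ is a smooth, flexible, factorial affine variety if and only if $Y$ is smooth and factorial, $f$ is a prime element of $\mathbb{K}[Y]$, and the zero set $\{f=0\}$ is a smooth subvariety of $Y$. -/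

import Mathlib

open Polynomial

noncomputable section

namespace AffineFlexibility

/-- The `K`-algebra `A` is the coordinate ring of an affine variety (not necessarily irreducible):
it is finitely generated and reduced. -/
def IsAffineVariety (K A : Type*) [Field K] [CommRing A] [Algebra K A] : Prop :=
  Algebra.FiniteType K A ∧ IsReduced A

/-- A regular action of the additive group `𝔾ₐ = (K, +)` on the affine variety `X` with coordinate
ring `A` over an infinite field. The morphism `𝔾ₐ × X → X` is given by its comorphism
`A → A[t] = K[𝔾ₐ × X]`; substituting `t = s` for `s : K` gives the comorphism of the action
of the element `s`. -/
structure GaAction (K A : Type*) [Field K] [CommRing A] [Algebra K A] where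
  comorphism : A →ₐ[K] A[X]
  zero_act : ∀ a : A, (comorphism a).eval 0 = a
  add_act : ∀ (s t : K) (a : A), (comorphism a).eval (algebraMap K A (s + t)) =
    (comorphism ((comorphism a).eval (algebraMap K A s))).eval (algebraMap K A t)

section

variable {K A : Type*} [Field K] [CommRing A] [Algebra K A]

/-- The tangent space at a point `x` (a `K`-algebra homomorphism `A → K`), as the space
of `K`-linear derivations `A → K` at `x`. -/
def tangentSpace (x : A →ₐ[K] K) : Submodule K (A →ₗ[K] K) where
  carrier := {D | ∀ a b : A, D (a * b) = x a * D b + x b * D a}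
  add_mem' := by
    intro D E hD hE a b
    simp only [Set.mem_ofPred_eq] at hD hE
    simp only [LinearMap.add_apply, hD, hE]
    ring
  zero_mem' := by intro a b; simp
  smul_mem' := by
    intro c D hD a b
    simp only [Set.mem_ofPred_eq] at hD
    simp only [LinearMap.smul_apply, hD, smul_eq_mul]
    ring

/-- The velocity at `t = 0` of the orbit `t ↦ t • x`: it sends a function `a` to the derivative
at `t = 0` of the polynomial `a (t • x)`. It spans the tangent line of the orbit of `x` at `x`
(characteristic zero), or is zero if `x` is a fixed point. -/
def GaAction.velocity (φ : GaAction K A) (x : A →ₐ[K] K) : A →ₗ[K] K where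
  toFun a := (derivative ((φ.comorphism a).map (x : A →+* K))).eval 0
  map_add' := by intro a b; simp
  map_smul' := by intro c a; simp

/-- The point `x` is a smooth point: `A` is smooth over `K` at the maximal ideal of `x`. -/
def IsSmoothPoint (x : A →ₐ[K] K) : Prop :=
  (⟨RingHom.ker x, RingHom.ker_isPrime x⟩ : PrimeSpectrum A) ∈ Algebra.smoothLocus K A

/-- The tangent space at `x` is spanned by the tangent vectors to the orbits through `x`
of the regular `𝔾ₐ`-actions. -/
def IsFlexiblePoint (x : A →ₐ[K] K) : Prop :=
  Submodule.span K (Set.range fun φ : GaAction K A => φ.velocity x) = tangentSpace x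

end

/-- Every smooth point is flexible. -/
def IsFlexible (K A : Type*) [Field K] [CommRing A] [Algebra K A] : Prop :=
  ∀ x : A →ₐ[K] K, IsSmoothPoint x → IsFlexiblePoint x

/-- The coordinate ring is a unique factorization domain. -/
def IsFactorial (A : Type*) [CommRing A] : Prop :=
  IsDomain A ∧ UniqueFactorizationMonoid A

/-- The coordinate ring `A[u, v] / (u v - f)` of the suspension over the variety with coordinate
ring `A`, where `u = X 0` and `v = X 1`. -/
abbrev Susp {A : Type*} [CommRing A] (f : A) : Type _ :=
  MvPolynomial (Fin 2) A ⧸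
    Ideal.span {(MvPolynomial.X 0 * MvPolynomial.X 1 - MvPolynomial.C f : MvPolynomial (Fin 2) A)}

/-- The coordinate ring of the closed subvariety `{f = 0}` (with its reduced structure). -/
abbrev ZeroSet {A : Type*} [CommRing A] (f : A) : Type _ :=
  A ⧸ (Ideal.span {f}).radical

end AffineFlexibility

end

/-! Write `R` for the coordinate ring of Y. A `𝔾ₐ`-action on Y with generator ∂ lifts to the
suspension by running it for time u·t: since f(ut • y) − f(y) is divisible by u, the point keeps u
and only v has to be corrected. The lift has velocity u∂ on the base, 0 on u and ∂f on v; exchanging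
u and v gives a second family. Where u ≠ 0, the two families span the tangent space as soon as some
∂f is nonzero at the base point (`Susp.isFlexiblePoint_of_derivation_ne_zero`).

Such base points can always be reached. An ideal stable under all generators and vanishing at a
flexible point is zero: an Euler field built from generators forces it into every power of the
maximal ideal (`eq_bot_of_derivation_stable`). Hence a nonconstant f is moved by some action
somewhere on each orbit, and in particular f is not a unit. A point with u = v = 0 is first pushed
to v ≠ 0.

Smoothness is controlled by a vector field D on Y with D f ≡ 1 mod f. When Y is smooth, such a D
exists if {f = 0} or the suspension is smooth (splitting of the conormal sequence), and conversely
it makes both smooth by correcting infinitesimal lifts along D.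

Factoriality is Nagata's criterion: inverting u gives `R[u, u⁻¹]`, and the quotient by u is
`(R/f)[v]`, so u is prime exactly when f is. In the forward direction u is irreducible because f is
not a unit, hence prime by factoriality. -/

noncomputable section

namespace AffineFlexibility

/-! ### `𝔾ₐ`-actions, their generators and orbits -/

section GaActions

variable {K A : Type*} [Field K] [CommRing A] [Algebra K A]

/-- Evaluation of polynomials at a scalar, as a `K`-algebra homomorphism. -/
def evalScalar (K A : Type*) [Field K] [CommRing A] [Algebra K A] (s : K) : A[X] →ₐ[K] A :=
  (Polynomial.aeval (R := A) (algebraMap K A s)).restrictScalars K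

@[simp]
lemma evalScalar_apply (s : K) (p : A[X]) :
    evalScalar K A s p = p.eval (algebraMap K A s) := by
  simp [evalScalar, Polynomial.coe_aeval_eq_eval]

namespace GaAction

/-- The comorphism of the action of `s`. -/
def act (φ : GaAction K A) (s : K) : A →ₐ[K] A :=
  (evalScalar K A s).comp φ.comorphism

lemma act_apply (φ : GaAction K A) (s : K) (a : A) :
    φ.act s a = (φ.comorphism a).eval (algebraMap K A s) := by
  simp [act]

lemma act_zero (φ : GaAction K A) (a : A) : φ.act 0 a = a := by
  simp [act_apply, φ.zero_act]

lemma act_add (φ : GaAction K A) (s t : K) (a : A) :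
    φ.act (s + t) a = φ.act t (φ.act s a) := by
  simp only [act_apply, φ.add_act]

/-- The action of `s` as an automorphism. -/
def actEquiv (φ : GaAction K A) (s : K) : A ≃ₐ[K] A :=
  AlgEquiv.ofAlgHom (φ.act s) (φ.act (-s))
    (by ext a; simp [← act_add, act_zero]) (by ext a; simp [← act_add, act_zero])

@[simp]
lemma coeff_zero_comorphism (φ : GaAction K A) (a : A) : (φ.comorphism a).coeff 0 = a := by
  rw [Polynomial.coeff_zero_eq_eval_zero, φ.zero_act]

/-- The infinitesimal generator of a `𝔾ₐ`-action. -/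
def derivation (φ : GaAction K A) : Derivation K A A :=
  Derivation.mk'
    { toFun := fun a => (φ.comorphism a).coeff 1
      map_add' := by intro a b; simp
      map_smul' := by intro c a; simp }
    (by
      intro a b
      simp [Polynomial.mul_coeff_one, mul_comm])

lemma derivation_apply (φ : GaAction K A) (a : A) :
    φ.derivation a = (φ.comorphism a).coeff 1 := rfl

lemma velocity_apply (φ : GaAction K A) (x : A →ₐ[K] K) (a : A) :
    φ.velocity x a = x (φ.derivation a) := by
  simp [velocity, derivation_apply, ← Polynomial.coeff_zero_eq_eval_zero,
    Polynomial.coeff_derivative]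

lemma velocity_mem_tangentSpace (φ : GaAction K A) (x : A →ₐ[K] K) :
    φ.velocity x ∈ tangentSpace x := by
  intro a b
  simp [velocity_apply]

/-- Transport of a `𝔾ₐ`-action along an automorphism. -/
def conj (φ : GaAction K A) (e : A ≃ₐ[K] A) : GaAction K A where
  comorphism := (Polynomial.mapAlgHom (e : A →ₐ[K] A)).comp
    (φ.comorphism.comp (e.symm : A →ₐ[K] A))
  zero_act a := by
    have h := φ.zero_act (e.symm a)
    have := Polynomial.eval_map_apply (f := (e : A →+* A)) (p := φ.comorphism (e.symm a)) 0
    simp only [map_zero, h] at this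
    simpa using this
  add_act s t a := by
    have key : ∀ (c : K) (b : A),
        ((φ.comorphism b).map (e : A →+* A)).eval (algebraMap K A c) = e (φ.act c b) := by
      intro c b
      rw [act_apply]
      have := Polynomial.eval_map_apply (f := (e : A →+* A)) (p := φ.comorphism b)
        (algebraMap K A c)
      simpa using this
    have h : ∀ b : A, (((Polynomial.mapAlgHom (e : A →ₐ[K] A)).comp
        (φ.comorphism.comp (e.symm : A →ₐ[K] A))) b) =
          (φ.comorphism (e.symm b)).map (e : A →+* A) := fun b => rfl
    simp only [h, key, act_add, AlgEquiv.symm_apply_apply]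

lemma conj_derivation (φ : GaAction K A) (e : A ≃ₐ[K] A) (a : A) :
    (φ.conj e).derivation a = e (φ.derivation (e.symm a)) := by
  simp [derivation_apply, conj]

end GaAction

/-- Flexibility of a point is invariant under automorphisms. -/
lemma IsFlexiblePoint.comp_equiv {x : A →ₐ[K] K} (hx : IsFlexiblePoint x) (e : A ≃ₐ[K] A) :
    IsFlexiblePoint (x.comp (e : A →ₐ[K] A)) := by
  apply le_antisymm
  · rw [Submodule.span_le]
    rintro _ ⟨φ, rfl⟩
    exact φ.velocity_mem_tangentSpace _
  · intro D hD
    have hD' : D ∘ₗ (e.symm.toLinearMap : A →ₗ[K] A) ∈ tangentSpace x := by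
      intro a b
      have := hD (e.symm a) (e.symm b)
      simpa using this
    rw [← hx] at hD'
    have key : ∀ E ∈ Submodule.span K (Set.range fun φ : GaAction K A => φ.velocity x),
        E ∘ₗ (e.toLinearMap : A →ₗ[K] A) ∈ Submodule.span K
          (Set.range fun φ : GaAction K A => φ.velocity (x.comp (e : A →ₐ[K] A))) := by
      intro E hE
      induction hE using Submodule.span_induction with
      | mem E hE =>
        obtain ⟨φ, rfl⟩ := hE
        refine Submodule.subset_span ⟨φ.conj e.symm, ?_⟩
        ext a
        simp [GaAction.velocity_apply, GaAction.conj_derivation]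
      | zero => simp
      | add E F _ _ h1 h2 => rw [LinearMap.add_comp]; exact add_mem h1 h2
      | smul c E _ h => rw [LinearMap.smul_comp]; exact Submodule.smul_mem _ _ h
    have := key _ hD'
    convert this using 1
    ext a
    simp

/-- `z` is obtained from `y` by successively applying elements of `𝔾ₐ`-actions. -/
def Reach : (A →ₐ[K] K) → (A →ₐ[K] K) → Prop :=
  Relation.ReflTransGen fun y z => ∃ (φ : GaAction K A) (s : K), z = y.comp (φ.act s)

lemma Reach.isFlexiblePoint {y z : A →ₐ[K] K} (h : Reach y z) (hz : IsFlexiblePoint z) :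
    IsFlexiblePoint y := by
  induction h using Relation.ReflTransGen.head_induction_on with
  | refl => exact hz
  | head hstep _ ih =>
    obtain ⟨φ, s, rfl⟩ := hstep
    have := ih.comp_equiv (φ.actEquiv s).symm
    convert this using 1
    ext a
    change _ = ((_ : A →ₐ[K] K).comp ((φ.actEquiv s : A →ₐ[K] A))) ((φ.actEquiv s).symm a)
    simp

/-- The polynomial `a (t • x)` translated by `s` is the polynomial of the translated point. -/
lemma GaAction.map_comorphism_comp [Infinite K] (φ : GaAction K A) (x : A →ₐ[K] K) (s : K)
    (a : A) :
    ((φ.comorphism a).map (x : A →+* K)).comp (X + C s) =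
      (φ.comorphism a).map ((x.comp (φ.act s) : A →ₐ[K] K) : A →+* K) := by
  have key : ∀ (y : A →ₐ[K] K) (t : K),
      ((φ.comorphism a).map (y : A →+* K)).eval t = y (φ.act t a) := by
    intro y t
    rw [GaAction.act_apply]
    have := Polynomial.eval_map_apply (f := (y : A →+* K)) (p := φ.comorphism a)
      (algebraMap K A t)
    simpa using this
  apply Polynomial.funext
  intro t
  rw [key, Polynomial.eval_comp, key]
  simp [GaAction.act_add]

lemma GaAction.eval_derivative_map [Infinite K] (φ : GaAction K A) (x : A →ₐ[K] K) (s : K)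
    (a : A) :
    (derivative ((φ.comorphism a).map (x : A →+* K))).eval s =
      (x.comp (φ.act s)) (φ.derivation a) := by
  rw [← GaAction.velocity_apply]
  change _ = (derivative ((φ.comorphism a).map
    ((x.comp (φ.act s) : A →ₐ[K] K) : A →+* K))).eval 0
  rw [← GaAction.map_comorphism_comp, Polynomial.derivative_comp]
  simp

/-- Along each action the function restricts to a polynomial in the time, whose derivative is the
generator's value at the moved point. In characteristic zero a vanishing derivative makes it
constant. -/
lemma apply_eq_of_forall_derivation_eq_zero [CharZero K] {y z : A →ₐ[K] K} {f : A}
    (h : ∀ w, Reach y w → ∀ φ : GaAction K A, w (φ.derivation f) = 0) (hz : Reach y z) :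
    z f = y f := by
  have main : ∀ z, Reach y z → z f = y f := by
    intro z hz
    induction hz with
    | refl => rfl
    | tail hw hstep ih =>
      rename_i w _
      obtain ⟨φ, s, rfl⟩ := hstep
      rw [← ih]
      have hd : derivative ((φ.comorphism f).map (w : A →+* K)) = 0 := by
        apply Polynomial.funext
        intro t
        rw [GaAction.eval_derivative_map, Polynomial.eval_zero]
        exact h _ (hw.tail ⟨φ, t, rfl⟩) φ
      have hc := Polynomial.eq_C_of_derivative_eq_zero hd
      have e1 : ((φ.comorphism f).map (w : A →+* K)).eval s = w (φ.act s f) := by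
        rw [GaAction.act_apply]
        have := Polynomial.eval_map_apply (f := (w : A →+* K)) (p := φ.comorphism f)
          (algebraMap K A s)
        simpa using this
      rw [AlgHom.comp_apply, ← e1, hc]
      simp
  exact main z hz

/-- The ideal of functions vanishing on everything reachable from `y`. -/
def reachIdeal (y : A →ₐ[K] K) : Ideal A :=
  ⨅ (z : A →ₐ[K] K) (_ : Reach y z), RingHom.ker z

lemma mem_reachIdeal {y : A →ₐ[K] K} {a : A} :
    a ∈ reachIdeal y ↔ ∀ z, Reach y z → z a = 0 := by
  simp [reachIdeal]

/-- The reachable set is stable under every action, so the function is identically zero along each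
orbit curve, and so is its velocity. -/
lemma derivation_mem_reachIdeal [CharZero K] {y : A →ₐ[K] K} {a : A} (φ : GaAction K A)
    (ha : a ∈ reachIdeal y) : φ.derivation a ∈ reachIdeal y := by
  rw [mem_reachIdeal] at ha ⊢
  intro z hz
  have h0 : (φ.comorphism a).map (z : A →+* K) = 0 := by
    apply Polynomial.funext
    intro t
    have := ha _ (hz.tail ⟨φ, t, rfl⟩)
    rw [AlgHom.comp_apply, GaAction.act_apply] at this
    have h2 := Polynomial.eval_map_apply (f := (z : A →+* K)) (p := φ.comorphism a)
      (algebraMap K A t)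
    simp only [AlgHom.coe_toRingHom, AlgHom.commutes, Algebra.algebraMap_self,
      RingHom.id_apply, this] at h2
    rw [h2, Polynomial.eval_zero]
  rw [← GaAction.velocity_apply]
  change (derivative ((φ.comorphism a).map (z : A →+* K))).eval 0 = 0
  rw [h0, Polynomial.derivative_zero, Polynomial.eval_zero]

end GaActions

/-! ### The Euler field at a flexible point and its consequences -/

section Euler

variable {K A : Type*} [Field K] [CommRing A] [Algebra K A]

/-- A derivation acting as the identity on `𝔪/𝔪²` acts as multiplication by `k`
on `𝔪ᵏ/𝔪ᵏ⁺¹`. -/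
lemma Derivation.sub_nsmul_mem_pow_succ {m : Ideal A} (E : Derivation K A A)
    (h0 : ∀ a, E a ∈ m) (h1 : ∀ a ∈ m, E a - a ∈ m ^ 2) (k : ℕ) :
    ∀ a ∈ m ^ k, E a - k * a ∈ m ^ (k + 1) := by
  induction k with
  | zero => intro a _; simpa using h0 a
  | succ k ih =>
    intro a ha
    rw [pow_succ] at ha
    induction ha using Submodule.mul_induction_on' with
    | mem_mul_mem p hp q hq =>
      have e : E (p * q) - ((k + 1 : ℕ) : A) * (p * q) =
          p * (E q - q) + (E p - k * p) * q := by
        simp only [Derivation.leibniz, smul_eq_mul, Nat.cast_add, Nat.cast_one]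
        ring
      rw [e]
      refine add_mem ?_ ?_
      · have := Ideal.mul_mem_mul hp (h1 q hq)
        rwa [← pow_add, show k + 2 = k + 1 + 1 by ring] at this
      · have := Ideal.mul_mem_mul (ih p hp) hq
        rwa [← pow_succ] at this
    | add p _ q _ hp hq =>
      have e : E (p + q) - ((k + 1 : ℕ) : A) * (p + q) =
          (E p - ((k + 1 : ℕ) : A) * p) + (E q - ((k + 1 : ℕ) : A) * q) := by
        rw [map_add]; ring
      rw [e]
      exact add_mem hp hq

/-- Finitely many functions vanishing at a point, with dual tangent vectors, which form a basis of
the cotangent space. -/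
lemma exists_dual_tangent [IsNoetherianRing A] (y : A →ₐ[K] K) :
    ∃ (n : ℕ) (x : Fin n → A) (D : Fin n → (A →ₗ[K] K)),
      (∀ i, x i ∈ RingHom.ker y) ∧ (∀ i, D i ∈ tangentSpace y) ∧
      ∀ a ∈ RingHom.ker y, ∑ i, algebraMap K A (D i a) * x i - a ∈ (RingHom.ker y) ^ 2 := by
  set m : Ideal A := RingHom.ker y with hm
  let q : A →ₗ[K] A ⧸ m ^ 2 := (Ideal.Quotient.mkₐ K (m ^ 2)).toLinearMap
  have hq : ∀ a, q a = 0 ↔ a ∈ m ^ 2 := fun a => Ideal.Quotient.eq_zero_iff_mem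
  -- This is the cotangent space 𝔪/𝔪², on which `A` acts through `y`; that is why ideal generators
  -- also span it over `K`.
  let V : Submodule K (A ⧸ m ^ 2) := (m.restrictScalars K).map q
  have hproj : ∀ a, a - algebraMap K A (y a) ∈ m := by
    intro a; simp [hm, RingHom.mem_ker]
  have hVfg : V.FG := by
    obtain ⟨s, hs⟩ := (isNoetherianRing_iff_ideal_fg A).1 inferInstance m
    classical
    refine ⟨s.image q, le_antisymm ?_ ?_⟩
    · rw [Submodule.span_le]
      intro z hz
      simp only [Finset.coe_image, Set.mem_image, Finset.mem_coe] at hz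
      obtain ⟨a, ha, rfl⟩ := hz
      exact ⟨a, by rw [← hs]; exact Submodule.subset_span ha, rfl⟩
    · rintro _ ⟨a, ha, rfl⟩
      have ha' : a ∈ Submodule.span A (s : Set A) := by
        change a ∈ Ideal.span (s : Set A)
        rw [hs]; exact ha
      clear ha
      induction ha' using Submodule.span_induction with
      | mem a ha => exact Submodule.subset_span (by simpa using ⟨a, ha, rfl⟩)
      | zero => simp
      | add a b _ _ h1 h2 => rw [map_add]; exact add_mem h1 h2
      | smul c a ha h =>
        have ham : a ∈ m := by rw [← hs]; exact ha
        have : q (c • a) = y c • q a := by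
          rw [← map_smul, ← sub_eq_zero, ← map_sub, hq, smul_eq_mul, Algebra.smul_def, ← sub_mul,
            pow_two]
          exact Ideal.mul_mem_mul (hproj c) ham
        rw [this]
        exact Submodule.smul_mem _ _ h
  have : Module.Finite K V := Module.Finite.of_fg hVfg
  let b := Module.finBasis K V
  have hlift : ∀ i, ∃ a ∈ m, q a = b i := fun i => by
    obtain ⟨a, ha, h⟩ := (b i).2
    exact ⟨a, ha, h⟩
  choose x hxm hxq using hlift
  -- Sends a to the class of a − a(y). Composing with the coordinates of a basis of 𝔪/𝔪² gives the
  -- dual tangent vectors.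
  let p : A →ₗ[K] V := LinearMap.codRestrict V
    (q ∘ₗ (LinearMap.id - (Algebra.linearMap K A) ∘ₗ y.toLinearMap))
    (fun a => ⟨_, hproj a, rfl⟩)
  have hp : ∀ a, (p a : A ⧸ m ^ 2) = q (a - algebraMap K A (y a)) := fun a => rfl
  refine ⟨_, x, fun i => b.coord i ∘ₗ p, hxm, ?_, ?_⟩
  · intro i c d
    have : p (c * d) = y c • p d + y d • p c := by
      apply Subtype.ext
      change q (c * d - algebraMap K A (y (c * d))) = y c • q (d - algebraMap K A (y d)) +
        y d • q (c - algebraMap K A (y c))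
      rw [← map_smul, ← map_smul, ← LinearMap.map_add, ← sub_eq_zero, ← LinearMap.map_sub, hq,
        map_mul, map_mul, Algebra.smul_def, Algebra.smul_def, pow_two]
      convert! Ideal.mul_mem_mul (hproj c) (hproj d) using 1
      ring
    simp only [LinearMap.comp_apply, this, map_add, map_smul, smul_eq_mul]
  · intro a ha
    have hya : y a = 0 := ha
    have h1 := b.sum_repr (p a)
    have h2 := congrArg (fun v : V => (v : A ⧸ m ^ 2)) h1
    simp only [hp, hya, map_zero, sub_zero] at h2
    rw [← hq, map_sub, sub_eq_zero, ← h2]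
    simp only [map_sum, ← Algebra.smul_def, map_smul, hxq, LinearMap.comp_apply,
      Module.Basis.coord_apply, AddSubmonoidClass.coe_finsetSum, Submodule.coe_smul]

/-- Near a flexible point, no proper nonzero ideal vanishing at the point is stable under all
infinitesimal generators of `𝔾ₐ`-actions. -/
theorem eq_bot_of_derivation_stable [CharZero K] [IsNoetherianRing A] [IsDomain A]
    {y : A →ₐ[K] K} (hy : IsFlexiblePoint y) {I : Ideal A} (hI : I ≤ RingHom.ker y)
    (hst : ∀ (φ : GaAction K A), ∀ a ∈ I, φ.derivation a ∈ I) : I = ⊥ := by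
  obtain ⟨n, x, D, hx, hD, hsum⟩ := exists_dual_tangent y
  set m : Ideal A := RingHom.ker y with hm
  have hδ : ∀ E ∈ tangentSpace y, ∃ δ : Derivation K A A,
      (∀ a, y (δ a) = E a) ∧ ∀ a ∈ I, δ a ∈ I := by
    intro E hE
    rw [← hy] at hE
    induction hE using Submodule.span_induction with
    | mem E hE =>
      obtain ⟨φ, rfl⟩ := hE
      exact ⟨φ.derivation, fun a => (φ.velocity_apply y a).symm, hst φ⟩
    | zero => exact ⟨0, by simp, by simp⟩
    | add E F _ _ h1 h2 =>
      obtain ⟨d, hd, hd'⟩ := h1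
      obtain ⟨e, he, he'⟩ := h2
      exact ⟨d + e, by simp [hd, he], fun a ha => add_mem (hd' a ha) (he' a ha)⟩
    | smul c E _ h =>
      obtain ⟨d, hd, hd'⟩ := h
      refine ⟨c • d, by simp [hd], fun a ha => ?_⟩
      rw [Derivation.smul_apply, Algebra.smul_def]
      exact I.mul_mem_left _ (hd' a ha)
  choose δ hδy hδI using fun i => hδ (D i) (hD i)
  -- The Euler field: since δᵢ induces the tangent vector Dᵢ at `y`, it acts as the identity on
  -- 𝔪/𝔪².
  let E : Derivation K A A := ∑ i, x i • δ i
  have hE : ∀ a, E a = ∑ i, x i * δ i a := fun a => by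
    change Derivation.coeFnAddMonoidHom (∑ i, x i • δ i) a = _
    simp [map_sum, Finset.sum_apply, Derivation.coeFnAddMonoidHom]
  have h0 : ∀ a, E a ∈ m := fun a => by
    rw [hE]; exact sum_mem fun i _ => m.mul_mem_right _ (hx i)
  have h1 : ∀ a ∈ m, E a - a ∈ m ^ 2 := by
    intro a ha
    have e : E a - a = ∑ i, x i * (δ i a - algebraMap K A (D i a)) +
        (∑ i, algebraMap K A (D i a) * x i - a) := by
      rw [hE]
      simp only [mul_sub, Finset.sum_sub_distrib, mul_comm (x _) (algebraMap K A _)]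
      ring
    rw [e]
    refine add_mem (sum_mem fun i _ => ?_) (hsum a ha)
    rw [pow_two]
    refine Ideal.mul_mem_mul (hx i) ?_
    simp [hm, RingHom.mem_ker, hδy]
  -- For a in I ∩ 𝔪ᵏ⁺¹, stability gives E a ∈ 𝔪·I ⊆ 𝔪ᵏ⁺², while E a ≡ (k+1)a modulo 𝔪ᵏ⁺². Dividing
  -- by k+1 raises the order of a; Krull's intersection theorem then finishes.
  have hpow : ∀ k : ℕ, I ≤ m ^ (k + 1) := by
    intro k
    induction k with
    | zero => simpa using hI
    | succ k ih =>
      intro a ha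
      have hEa : E a ∈ m ^ (k + 1 + 1) := by
        rw [hE]
        refine sum_mem fun i _ => ?_
        rw [pow_succ']
        exact Ideal.mul_mem_mul (hx i) (ih (hδI i a ha))
      have hk := Derivation.sub_nsmul_mem_pow_succ E h0 h1 (k + 1) a (ih ha)
      have hka : ((k + 1 : ℕ) : A) * a ∈ m ^ (k + 1 + 1) := by
        have := sub_mem hEa hk
        rwa [sub_sub_cancel] at this
      have hc : ((k + 1 : ℕ) : K) ≠ 0 := Nat.cast_ne_zero.2 (Nat.succ_ne_zero k)
      have e : a = algebraMap K A ((k + 1 : ℕ) : K)⁻¹ * (((k + 1 : ℕ) : A) * a) := by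
        rw [← mul_assoc, ← map_natCast (algebraMap K A), ← map_mul, inv_mul_cancel₀ hc, map_one,
          one_mul]
      rw [e]
      exact Ideal.mul_mem_left _ _ hka
  rw [eq_bot_iff, ← Ideal.iInf_pow_eq_bot_of_isDomain m (RingHom.ker_ne_top y)]
  refine le_iInf fun k => ?_
  exact (hpow k).trans (Ideal.pow_le_pow_right (Nat.le_succ k))

/-- Starting at a flexible point, one reaches a point where some generator of a `𝔾ₐ`-action
moves a given nonconstant function. -/
theorem exists_reach_derivation_ne_zero [CharZero K] [IsNoetherianRing A] [IsDomain A]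
    {y : A →ₐ[K] K} (hy : IsFlexiblePoint y) {f : A} (hf : ∀ c : K, f ≠ algebraMap K A c) :
    ∃ z, Reach y z ∧ ∃ φ : GaAction K A, z (φ.derivation f) ≠ 0 := by
  by_contra! h
  have hbot : reachIdeal y = ⊥ := by
    refine eq_bot_of_derivation_stable hy ?_ fun φ a ha => derivation_mem_reachIdeal φ ha
    intro a ha
    exact mem_reachIdeal.1 ha y Relation.ReflTransGen.refl
  have hmem : f - algebraMap K A (y f) ∈ reachIdeal y := by
    rw [mem_reachIdeal]
    intro z hz
    simp [apply_eq_of_forall_derivation_eq_zero h hz]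
  rw [hbot, Ideal.mem_bot, sub_eq_zero] at hmem
  exact hf _ hmem

/-- Invertible functions are invariant under `𝔾ₐ`-actions. -/
lemma GaAction.derivation_eq_zero_of_isUnit [IsDomain A] (φ : GaAction K A) {f : A}
    (hf : IsUnit f) : φ.derivation f = 0 := by
  rw [GaAction.derivation_apply]
  apply Polynomial.coeff_eq_zero_of_natDegree_lt
  rw [Polynomial.natDegree_eq_zero_of_isUnit (hf.map φ.comorphism)]
  exact zero_lt_one

/-- A nonconstant function on a variety with a flexible point is not invertible. -/
lemma not_isUnit_of_isFlexiblePoint [CharZero K] [IsNoetherianRing A] [IsDomain A]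
    {y : A →ₐ[K] K} (hy : IsFlexiblePoint y) {f : A} (hf : ∀ c : K, f ≠ algebraMap K A c) :
    ¬ IsUnit f := by
  intro hu
  obtain ⟨z, _, φ, h⟩ := exists_reach_derivation_ne_zero hy hf
  exact h (by rw [φ.derivation_eq_zero_of_isUnit hu, map_zero])

end Euler

/-! ### The suspension: universal property and the exchange of u and v -/

namespace Susp

section Basic

variable {R : Type*} [CommRing R] (f : R)

/-- The coordinate function `u` on the suspension. -/
def u : Susp f := Ideal.Quotient.mk _ (MvPolynomial.X 0)

/-- The coordinate function `v` on the suspension. -/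
def v : Susp f := Ideal.Quotient.mk _ (MvPolynomial.X 1)

lemma mk_C (r : R) : (Ideal.Quotient.mk (Ideal.span
    {(MvPolynomial.X 0 * MvPolynomial.X 1 - MvPolynomial.C f : MvPolynomial (Fin 2) R)})
      (MvPolynomial.C r) : Susp f) = algebraMap R (Susp f) r := rfl

lemma u_mul_v : u f * v f = algebraMap R (Susp f) f := by
  rw [← sub_eq_zero, ← mk_C, u, v, ← map_mul, ← map_sub]
  exact Ideal.Quotient.eq_zero_iff_mem.2 (Ideal.mem_span_singleton_self _)

variable {f}

@[elab_as_elim]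
lemma induction_on {p : Susp f → Prop} (s : Susp f)
    (base : ∀ r, p (algebraMap R (Susp f) r)) (add : ∀ s t, p s → p t → p (s + t))
    (mul_u : ∀ s, p s → p (s * u f)) (mul_v : ∀ s, p s → p (s * v f)) : p s := by
  obtain ⟨q, rfl⟩ := Ideal.Quotient.mk_surjective s
  induction q using MvPolynomial.induction_on with
  | C r => exact base r
  | add a b ha hb => rw [map_add]; exact add _ _ ha hb
  | mul_X a i ha =>
    rw [map_mul]
    fin_cases i
    · exact mul_u _ ha
    · exact mul_v _ ha

variable {k B : Type*} [CommRing k] [Algebra k R] [CommRing B] [Algebra k B]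

/-- The universal property of the coordinate ring of the suspension. -/
def lift (g : R →ₐ[k] B) (a b : B) (h : a * b = g f) : Susp f →ₐ[k] B :=
  Ideal.Quotient.liftₐ _ (MvPolynomial.aevalTower g ![a, b]) (by
    intro p hp
    obtain ⟨q, rfl⟩ := Ideal.mem_span_singleton.1 hp
    simp [h])

variable (g : R →ₐ[k] B) (a b : B) (h : a * b = g f)

@[simp]
lemma lift_algebraMap (r : R) : lift g a b h (algebraMap R (Susp f) r) = g r := by
  rw [← mk_C]
  change MvPolynomial.aevalTower g ![a, b] (MvPolynomial.C r) = g r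
  simp

@[simp]
lemma lift_u : lift g a b h (u f) = a := by
  change MvPolynomial.aevalTower g ![a, b] (MvPolynomial.X 0) = a
  simp

@[simp]
lemma lift_v : lift g a b h (v f) = b := by
  change MvPolynomial.aevalTower g ![a, b] (MvPolynomial.X 1) = b
  simp

lemma algHom_ext {F G : Susp f →ₐ[k] B}
    (h0 : ∀ r, F (algebraMap R (Susp f) r) = G (algebraMap R (Susp f) r))
    (hu : F (u f) = G (u f)) (hv : F (v f) = G (v f)) : F = G := by
  ext s
  induction s using induction_on with
  | base r => exact h0 r
  | add s t hs ht => rw [map_add, map_add, hs, ht]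
  | mul_u s hs => rw [map_mul, map_mul, hs, hu]
  | mul_v s hs => rw [map_mul, map_mul, hs, hv]

variable (k f) in
/-- The inclusion of the coordinate ring of the base. -/
def incl : R →ₐ[k] Susp f := IsScalarTower.toAlgHom k R (Susp f)

@[simp]
lemma incl_apply (r : R) : incl f k r = algebraMap R (Susp f) r := rfl

variable (k f) in
/-- The automorphism exchanging `u` and `v`. -/
def swap : Susp f ≃ₐ[k] Susp f :=
  AlgEquiv.ofAlgHom
    (lift (incl f k) (v f) (u f) (by rw [mul_comm, u_mul_v]; rfl))
    (lift (incl f k) (v f) (u f) (by rw [mul_comm, u_mul_v]; rfl))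
    (algHom_ext (by simp) (by simp) (by simp))
    (algHom_ext (by simp) (by simp) (by simp))

@[simp] lemma swap_u : swap f k (u f) = v f :=
  lift_u (incl f k) (v f) (u f) (by rw [mul_comm, u_mul_v]; rfl)

@[simp] lemma swap_v : swap f k (v f) = u f :=
  lift_v (incl f k) (v f) (u f) (by rw [mul_comm, u_mul_v]; rfl)

@[simp] lemma swap_algebraMap (r : R) :
    swap f k (algebraMap R (Susp f) r) = algebraMap R (Susp f) r :=
  lift_algebraMap (incl f k) (v f) (u f) (by rw [mul_comm, u_mul_v]; rfl) r

@[simp] lemma swap_symm : (swap f k).symm = swap f k := rfl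

end Basic

/-! ### Inverting u -/

section Laurent

variable {R : Type*} [CommRing R] (f : R)

/-- Away from `u = 0`, the suspension is the product of the base with the punctured line. -/
def toLaurent : Susp f →ₐ[R] LaurentPolynomial R :=
  lift (k := R) (Algebra.ofId R (LaurentPolynomial R)) (LaurentPolynomial.T 1)
    (LaurentPolynomial.C f * LaurentPolynomial.T (-1)) (by
      rw [mul_left_comm, ← LaurentPolynomial.T_add]
      simp [Algebra.ofId_apply, LaurentPolynomial.algebraMap_apply])

@[simp] lemma toLaurent_u : toLaurent f (u f) = LaurentPolynomial.T 1 := lift_u ..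

lemma algebraMap_injective : Function.Injective (algebraMap R (Susp f)) := by
  intro a b h
  have h2 := congrArg (toLaurent f) h
  rw [AlgHom.commutes, AlgHom.commutes, LaurentPolynomial.algebraMap_apply,
    LaurentPolynomial.algebraMap_apply, ← Polynomial.toLaurent_C, ← Polynomial.toLaurent_C] at h2
  exact Polynomial.C_injective (Polynomial.toLaurent_injective h2)

lemma toLaurent_aeval_u (q : R[X]) :
    toLaurent f (aeval (u f) q) = Polynomial.toLaurent q := by
  rw [← Polynomial.aeval_algHom_apply, toLaurent_u]
  induction q using Polynomial.induction_on' with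
  | add p q hp hq => simp [hp, hq]
  | monomial n a =>
    simp [Polynomial.aeval_monomial, LaurentPolynomial.algebraMap_apply]

variable {f}

/-- Since v = f/u, multiplying by a power of u clears every v. -/
lemma exists_u_pow_mul_eq_aeval (s : Susp f) :
    ∃ (n : ℕ) (q : R[X]), u f ^ n * s = aeval (u f) q := by
  induction s using induction_on with
  | base r => exact ⟨0, C r, by simp⟩
  | add s t hs ht =>
    obtain ⟨n, q, hq⟩ := hs
    obtain ⟨m, p, hp⟩ := ht
    refine ⟨n + m, X ^ m * q + X ^ n * p, ?_⟩
    simp only [map_add, map_mul, map_pow, aeval_X, ← hq, ← hp]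
    ring
  | mul_u s hs =>
    obtain ⟨n, q, hq⟩ := hs
    exact ⟨n, q * X, by rw [← mul_assoc, hq]; simp⟩
  | mul_v s hs =>
    obtain ⟨n, q, hq⟩ := hs
    refine ⟨n + 1, q * C f, ?_⟩
    calc u f ^ (n + 1) * (s * v f) = (u f ^ n * s) * (u f * v f) := by ring
      _ = _ := by rw [hq, u_mul_v]; simp

lemma u_regular [IsDomain R] (hf : f ≠ 0) {s : Susp f} (h : u f * s = 0) : s = 0 := by
  obtain ⟨p, rfl⟩ := Ideal.Quotient.mk_surjective s
  rw [u, ← map_mul, Ideal.Quotient.eq_zero_iff_mem, Ideal.mem_span_singleton] at h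
  obtain ⟨q, hq⟩ := h
  -- The relation X₀p = (X₀X₁ − f)q shows X₀ ∣ f·q. As X₀ is prime and does not divide the nonzero
  -- constant f, it divides q.
  have hd : (MvPolynomial.X 0 : MvPolynomial (Fin 2) R) ∣ MvPolynomial.C f * q :=
    ⟨MvPolynomial.X 1 * q - p, by linear_combination hq⟩
  rcases MvPolynomial.X_prime.dvd_or_dvd hd with ⟨c, hc⟩ | ⟨c, rfl⟩
  · have := congrArg (MvPolynomial.eval (0 : Fin 2 → R)) hc
    simp [hf] at this
  · rw [Ideal.Quotient.eq_zero_iff_mem, Ideal.mem_span_singleton]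
    refine ⟨c, mul_left_cancel₀ (MvPolynomial.X_ne_zero (0 : Fin 2)) ?_⟩
    rw [hq]; ring

lemma u_pow_regular [IsDomain R] (hf : f ≠ 0) (n : ℕ) {s : Susp f} (h : u f ^ n * s = 0) :
    s = 0 := by
  induction n with
  | zero => simpa using h
  | succ n ih =>
    rw [pow_succ', mul_assoc] at h
    exact ih (u_regular hf h)

lemma toLaurent_injective [IsDomain R] (hf : f ≠ 0) : Function.Injective (toLaurent f) := by
  rw [injective_iff_map_eq_zero]
  intro s hs
  obtain ⟨n, q, hq⟩ := exists_u_pow_mul_eq_aeval s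
  have h := congrArg (toLaurent f) hq
  rw [map_mul, hs, mul_zero, toLaurent_aeval_u, eq_comm, Polynomial.toLaurent_eq_zero] at h
  rw [h, map_zero] at hq
  exact u_pow_regular hf n hq

lemma isDomain [IsDomain R] (hf : f ≠ 0) : IsDomain (Susp f) :=
  (toLaurent_injective hf).isDomain (toLaurent f).toRingHom

lemma u_ne_zero [Nontrivial R] : u f ≠ 0 := by
  intro h
  have := congrArg (toLaurent f) h
  rw [toLaurent_u, map_zero] at this
  exact (LaurentPolynomial.isUnit_T (R := R) 1).ne_zero this

lemma isLocalization [IsDomain R] (hf : f ≠ 0) :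
    letI := (toLaurent f).toRingHom.toAlgebra
    IsLocalization.Away (u f) (LaurentPolynomial R) := by
  let := (toLaurent f).toRingHom.toAlgebra
  have hmap : ∀ s : Susp f, algebraMap (Susp f) (LaurentPolynomial R) s = toLaurent f s :=
    fun s => rfl
  exact
    { map_units := by
        rintro ⟨_, n, rfl⟩
        simp only [hmap, map_pow, toLaurent_u]
        exact (LaurentPolynomial.isUnit_T 1).pow n
      surj := by
        intro z
        obtain ⟨n, q, hq⟩ := z.exists_T_pow
        refine ⟨⟨aeval (u f) q, ⟨_, n, rfl⟩⟩, ?_⟩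
        simp [hmap, toLaurent_aeval_u, hq]
      exists_of_eq := by
        intro x y h
        exact ⟨1, by rw [toLaurent_injective hf h]⟩ }

end Laurent

/-! ### Reduction modulo u, primality and irreducibility of u -/

section ModU

variable {R : Type*} [CommRing R] (f : R)

/-- Restriction to the locus `u = 0`, which is the product of `{f = 0}` with a line. -/
def modU : Susp f →ₐ[R] (R ⧸ Ideal.span {f})[X] :=
  lift (k := R) (Algebra.ofId R _) 0 X (by
    rw [zero_mul, Algebra.ofId_apply, Polynomial.algebraMap_apply, Ideal.Quotient.algebraMap_eq,
      Ideal.Quotient.eq_zero_iff_mem.2 (Ideal.mem_span_singleton_self f), map_zero])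

@[simp] lemma modU_u : modU f (u f) = 0 := lift_u ..

@[simp] lemma modU_v : modU f (v f) = X := lift_v ..

lemma modU_algebraMap (r : R) :
    modU f (algebraMap R (Susp f) r) = C (Ideal.Quotient.mk _ r) := by
  rw [AlgHom.commutes, Polynomial.algebraMap_apply]; rfl

lemma modU_aeval_v (q : R[X]) :
    modU f (aeval (v f) q) = q.map (Ideal.Quotient.mk (Ideal.span {f})) := by
  rw [← Polynomial.aeval_algHom_apply, modU_v]
  induction q using Polynomial.induction_on' with
  | add p q hp hq => simp [hp, hq]
  | monomial n a =>
    simp [Polynomial.aeval_monomial, Polynomial.algebraMap_apply, C_mul_X_pow_eq_monomial]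

variable {f}

lemma exists_eq_u_mul_add_aeval (s : Susp f) :
    ∃ (t : Susp f) (q : R[X]), s = u f * t + aeval (v f) q := by
  induction s using induction_on with
  | base r => exact ⟨0, C r, by simp⟩
  | add s t hs ht =>
    obtain ⟨a, q, rfl⟩ := hs
    obtain ⟨b, p, rfl⟩ := ht
    exact ⟨a + b, q + p, by rw [map_add]; ring⟩
  | mul_u s hs => exact ⟨s, 0, by simp [mul_comm]⟩
  | mul_v s hs =>
    obtain ⟨a, q, rfl⟩ := hs
    exact ⟨a * v f, q * X, by simp only [map_mul, aeval_X]; ring⟩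

lemma u_dvd_of_modU_eq_zero {s : Susp f} (h : modU f s = 0) : u f ∣ s := by
  obtain ⟨t, q, rfl⟩ := exists_eq_u_mul_add_aeval s
  rw [map_add, map_mul, modU_u, zero_mul, zero_add, modU_aeval_v] at h
  refine dvd_add (dvd_mul_right _ _) ?_
  -- All coefficients are multiples of f, and f = uv.
  have hq : C f ∣ q := by
    rw [Polynomial.C_dvd_iff_dvd_coeff]
    intro i
    have := congrArg (fun p => p.coeff i) h
    simp only [Polynomial.coeff_map, Polynomial.coeff_zero] at this
    exact Ideal.mem_span_singleton.1 (Ideal.Quotient.eq_zero_iff_mem.1 this)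
  obtain ⟨p, rfl⟩ := hq
  rw [map_mul, Polynomial.aeval_C, ← u_mul_v, mul_assoc]
  exact dvd_mul_right _ _

lemma prime_u [IsDomain R] (hf : Prime f) : Prime (u f) := by
  have : (Ideal.span {f}).IsPrime := (Ideal.span_singleton_prime hf.ne_zero).2 hf
  have hker : RingHom.ker (modU f) = Ideal.span {u f} := by
    apply le_antisymm
    · intro s hs
      exact Ideal.mem_span_singleton.2 (u_dvd_of_modU_eq_zero hs)
    · rw [Ideal.span_singleton_le_iff_mem]
      exact modU_u f
  rw [← Ideal.span_singleton_prime u_ne_zero, ← hker]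
  exact RingHom.ker_isPrime _

lemma dvd_of_u_dvd_algebraMap {r : R} (h : u f ∣ algebraMap R (Susp f) r) : f ∣ r := by
  obtain ⟨t, ht⟩ := h
  have := congrArg (modU f) ht
  rw [map_mul, modU_u, zero_mul, modU_algebraMap, Polynomial.C_eq_zero,
    Ideal.Quotient.eq_zero_iff_mem, Ideal.mem_span_singleton] at this
  exact this

lemma prime_of_prime_u (hf0 : f ≠ 0) (hf : ¬ IsUnit f) (hu : Prime (u f)) : Prime f := by
  refine ⟨hf0, hf, fun a b hab => ?_⟩
  have h : u f ∣ algebraMap R (Susp f) a * algebraMap R (Susp f) b := by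
    rw [← map_mul]
    refine dvd_trans ⟨v f, (u_mul_v f).symm⟩ (map_dvd _ hab)
  exact (hu.dvd_or_dvd h).imp dvd_of_u_dvd_algebraMap dvd_of_u_dvd_algebraMap

/-- A factor of a power of `u` is a unit of the base times a power of `u`. -/
lemma exists_eq_u_pow_mul_of_aeval_dvd [IsDomain R] (hf0 : f ≠ 0) (hf : ¬ IsUnit f) {s : Susp f}
    {n N : ℕ} {q : R[X]} (hs : u f ^ n * s = aeval (u f) q) (hq : q ∣ X ^ N) :
    ∃ (i : ℕ) (c : R), IsUnit c ∧ Associated q (X ^ (n + i)) ∧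
      s = u f ^ i * algebraMap R (Susp f) c := by
  obtain ⟨j, _, hj⟩ := (dvd_prime_pow Polynomial.prime_X N).1 hq
  obtain ⟨w, hw⟩ := hj.symm
  obtain ⟨c, hc, hcw⟩ := Polynomial.isUnit_iff.1 w.isUnit
  have hs' : u f ^ n * s = u f ^ j * algebraMap R (Susp f) c := by
    rw [hs, ← hw, ← hcw, map_mul, map_pow, aeval_X, aeval_C]
  -- Otherwise cancelling uʲ makes the unit c a multiple of u, hence of f modulo nothing but the
  -- base: f would be a unit.
  have hnj : n ≤ j := by
    by_contra hlt
    push Not at hlt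
    obtain ⟨d, rfl⟩ := Nat.exists_eq_add_of_lt hlt
    have h0 : u f ^ j * (u f ^ (d + 1) * s - algebraMap R (Susp f) c) = 0 := by
      rw [mul_sub, ← hs', ← mul_assoc, ← pow_add, add_assoc, sub_self]
    have h1 := sub_eq_zero.1 (u_pow_regular hf0 j h0)
    have h2 : f ∣ c := dvd_of_u_dvd_algebraMap (by
      rw [← h1, pow_succ', mul_assoc]; exact dvd_mul_right _ _)
    exact hf (isUnit_of_dvd_unit h2 hc)
  obtain ⟨i, rfl⟩ := Nat.exists_eq_add_of_le hnj
  refine ⟨i, c, hc, hj, ?_⟩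
  have h0 : u f ^ n * (s - u f ^ i * algebraMap R (Susp f) c) = 0 := by
    rw [mul_sub, hs', ← mul_assoc, ← pow_add, sub_self]
  exact sub_eq_zero.1 (u_pow_regular hf0 n h0)

/-- After clearing v, the two factors of u become polynomials whose product is a power of `X`. Each
factor is therefore a unit of the base times a power of u, and comparing degrees leaves one exponent
equal to zero. -/
lemma irreducible_u [IsDomain R] (hf0 : f ≠ 0) (hf : ¬ IsUnit f) : Irreducible (u f) := by
  refine ⟨fun h => ?_, fun a b hab => ?_⟩
  · have : u f ∣ algebraMap R (Susp f) 1 := by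
      rw [map_one]; exact isUnit_iff_dvd_one.1 h
    exact hf (isUnit_iff_dvd_one.2 (dvd_of_u_dvd_algebraMap this))
  · obtain ⟨n, q, hq⟩ := exists_u_pow_mul_eq_aeval a
    obtain ⟨m, p, hp⟩ := exists_u_pow_mul_eq_aeval b
    have hqp : q * p = X ^ (n + m + 1) := by
      apply Polynomial.toLaurent_injective
      rw [← toLaurent_aeval_u f, ← toLaurent_aeval_u f, map_mul, ← hq, ← hp]
      congr 1
      simp only [map_pow, aeval_X]
      rw [pow_succ, pow_add]
      linear_combination -(u f ^ n * u f ^ m) * hab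
    obtain ⟨i, c, hc, hci, rfl⟩ := exists_eq_u_pow_mul_of_aeval_dvd hf0 hf hq ⟨p, hqp.symm⟩
    obtain ⟨j, d, hd, hdj, rfl⟩ := exists_eq_u_pow_mul_of_aeval_dvd hf0 hf hp
      ⟨q, by rw [mul_comm, hqp]⟩
    have hdeg : n + i + (m + j) = n + m + 1 := by
      have h1 := hci.mul_mul hdj
      rw [hqp, ← pow_add] at h1
      have h2 := Polynomial.degree_eq_degree_of_associated h1
      rw [Polynomial.degree_X_pow, Polynomial.degree_X_pow] at h2
      exact_mod_cast h2.symm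
    have : i = 0 ∨ j = 0 := by omega
    rcases this with rfl | rfl
    · left; simpa using hc.map (algebraMap R (Susp f))
    · right; simpa using hd.map (algebraMap R (Susp f))

end ModU

/-! ### Transfer of factoriality -/

section Factorial

variable {R : Type*} [CommRing R] {f : R}

/-- An irreducible constant stays irreducible in `R[X]` by degrees, so it is prime there and hence
in `R`. -/
lemma uniqueFactorizationMonoid_of_polynomial [IsDomain R] [IsNoetherianRing R]
    [UniqueFactorizationMonoid R[X]] : UniqueFactorizationMonoid R := by
  refine ⟨fun {a} => ⟨fun ha => ?_, Prime.irreducible⟩⟩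
  rw [← Polynomial.prime_C_iff, ← UniqueFactorizationMonoid.irreducible_iff_prime]
  refine ⟨fun h => ha.not_isUnit (Polynomial.isUnit_C.1 h), fun p q hpq => ?_⟩
  have hne : p * q ≠ 0 := by rw [← hpq]; simpa using ha.ne_zero
  have hdeg : p.natDegree + q.natDegree = 0 := by
    rw [← Polynomial.natDegree_mul (left_ne_zero_of_mul hne) (right_ne_zero_of_mul hne), ← hpq,
      Polynomial.natDegree_C]
  obtain ⟨c, rfl⟩ := Polynomial.natDegree_eq_zero.1 (show p.natDegree = 0 by omega)
  obtain ⟨d, rfl⟩ := Polynomial.natDegree_eq_zero.1 (show q.natDegree = 0 by omega)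
  rw [← C_mul, Polynomial.C_inj] at hpq
  simpa only [Polynomial.isUnit_C] using ha.isUnit_or_isUnit hpq

/-- Nagata's criterion applied twice: the Laurent ring is the suspension localized at the prime u
and also `R[X]` localized at the prime `X`. -/
lemma uniqueFactorizationMonoid_iff [IsDomain R] [IsNoetherianRing R] (hf0 : f ≠ 0)
    (hu : Prime (u f)) :
    UniqueFactorizationMonoid (Susp f) ↔ UniqueFactorizationMonoid R := by
  have := isDomain hf0
  let := (toLaurent f).toRingHom.toAlgebra
  have := isLocalization hf0
  rw [UniqueFactorizationMonoid.iff_of_isLocalizationAway_of_prime hu (LaurentPolynomial R),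
    ← UniqueFactorizationMonoid.iff_of_isLocalizationAway_of_prime
      (Polynomial.prime_X (R := R)) (LaurentPolynomial R)]
  exact ⟨fun _ => uniqueFactorizationMonoid_of_polynomial, fun _ => inferInstance⟩

end Factorial

end Susp

/-! ### Infinitesimal lifting and vector fields transverse to {f = 0} -/

section Smoothness

/-- An algebra retract of a formally smooth algebra is formally smooth. -/
lemma formallySmooth_of_retract {k A B : Type*} [CommRing k] [CommRing A] [CommRing B]
    [Algebra k A] [Algebra k B] [Algebra.FormallySmooth k B] (i : A →ₐ[k] B) (r : B →ₐ[k] A)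
    (h : r.comp i = AlgHom.id k A) : Algebra.FormallySmooth k A := by
  refine Algebra.FormallySmooth.of_comp_surjective fun C _ _ J hJ g => ?_
  obtain ⟨l, hl⟩ := Algebra.FormallySmooth.comp_surjective k B J hJ (g.comp r)
  refine ⟨l.comp i, ?_⟩
  change ((Ideal.Quotient.mkₐ k J).comp l).comp i = g
  rw [hl, AlgHom.comp_assoc, h, AlgHom.comp_id]

/-- The deformation `a ↦ ρ a + ε ρ(D a)` of an algebra homomorphism `ρ` along a derivation. -/
def deform {k A B : Type*} [CommRing k] [CommRing A] [CommRing B]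
    [Algebra k A] [Algebra k B] (ρ : A →ₐ[k] B) (D : Derivation k A A) (ε : B)
    (hε : ε * ε = 0) : A →ₐ[k] B :=
  AlgHom.ofLinearMap (ρ.toLinearMap + (LinearMap.mulLeft k ε) ∘ₗ ρ.toLinearMap ∘ₗ D.toLinearMap)
    (by simp)
    (by
      intro a b
      simp only [LinearMap.add_apply, LinearMap.comp_apply, AlgHom.toLinearMap_apply,
        LinearMap.mulLeft_apply, map_mul, Derivation.coeFn_coe,
        Derivation.leibniz, smul_eq_mul, map_add]
      linear_combination (-ρ (D a) * ρ (D b)) * hε)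

lemma deform_apply {k A B : Type*} [CommRing k] [CommRing A] [CommRing B]
    [Algebra k A] [Algebra k B] (ρ : A →ₐ[k] B) (D : Derivation k A A) (ε : B)
    (hε : ε * ε = 0) (a : A) : deform ρ D ε hε a = ρ a + ε * ρ (D a) := rfl

/-- A derivation with values in a quotient of a formally smooth algebra lifts. -/
lemma exists_derivation_lift {k A : Type*} [CommRing k] [CommRing A] [Algebra k A]
    [Algebra.FormallySmooth k A] {I : Ideal A} (D : Derivation k A (A ⧸ I)) :
    ∃ E : Derivation k A A, ∀ a, Ideal.Quotient.mk I (E a) = D a := by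
  obtain ⟨l, hl⟩ := Module.projective_lifting_property (Submodule.mkQ I)
    D.liftKaehlerDifferential (Submodule.mkQ_surjective I)
  refine ⟨l.compDer (KaehlerDifferential.D k A), fun a => ?_⟩
  have := LinearMap.congr_fun hl (KaehlerDifferential.D k A a)
  rwa [Derivation.liftKaehlerDifferential_comp_D] at this

/-- Jacobian criterion: the conormal sequence of a smooth hypersurface splits. -/
lemma exists_derivation_eq_one {k P : Type*} [CommRing k] [CommRing P] [IsDomain P] [Algebra k P]
    [Algebra.FormallySmooth k P] {g : P} (hg : g ≠ 0)
    [Algebra.FormallySmooth k (P ⧸ Ideal.span {g})] :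
    ∃ D : Derivation k P (P ⧸ Ideal.span {g}), D g = 1 := by
  set I : Ideal P := Ideal.span {g} with hI
  have hker : RingHom.ker (algebraMap P (P ⧸ I)) = I := Ideal.mk_ker
  obtain ⟨l, hl⟩ := (Algebra.FormallySmooth.iff_split_injection (R := k) (P := P) (A := P ⧸ I)
    Ideal.Quotient.mk_surjective).1 inferInstance
  let e : RingHom.ker (algebraMap P (P ⧸ I)) →ₗ[P] P :=
    (LinearEquiv.toSpanNonzeroSingleton P P g hg).symm.toLinearMap ∘ₗ
      (Submodule.inclusion hker.le)
  have he : ∀ x : RingHom.ker (algebraMap P (P ⧸ I)), e x * g = x := by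
    intro x
    have := LinearEquiv.toSpanNonzeroSingleton_symm_apply_smul P P g hg
      (Submodule.inclusion hker.le x)
    exact this
  -- Division by g, reduced modulo g; it descends to I/I² and sends the class of g to 1. The
  -- retraction `l` of the conormal map turns it into a derivation.
  let ψ₀ : RingHom.ker (algebraMap P (P ⧸ I)) →ₗ[P] P ⧸ I := I.mkQ ∘ₗ e
  let ψ : (RingHom.ker (algebraMap P (P ⧸ I))).Cotangent →ₗ[P] P ⧸ I :=
    Submodule.liftQ _ ψ₀ (by
      rw [Submodule.smul_le]
      intro a ha x _
      rw [LinearMap.mem_ker, map_smul]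
      rw [hker] at ha
      change Ideal.Quotient.mk I a * Ideal.Quotient.mk I (e x) = 0
      rw [Ideal.Quotient.eq_zero_iff_mem.2 ha, zero_mul])
  have hgk : g ∈ RingHom.ker (algebraMap P (P ⧸ I)) := by
    rw [hker]; exact Ideal.mem_span_singleton_self g
  refine ⟨(ψ ∘ₗ l ∘ₗ (TensorProduct.mk P (P ⧸ I) (Ω[P⁄k]) 1)).compDer
    (KaehlerDifferential.D k P), ?_⟩
  have h1 := LinearMap.congr_fun hl (Ideal.toCotangent _ ⟨g, hgk⟩)
  simp only [LinearMap.comp_apply, KaehlerDifferential.kerCotangentToTensor_toCotangent,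
    LinearMap.id_apply] at h1
  change ψ (l (1 ⊗ₜ KaehlerDifferential.D k P g)) = 1
  rw [h1]
  change Ideal.Quotient.mk I (e ⟨g, hgk⟩) = 1
  have : e ⟨g, hgk⟩ = 1 := mul_right_cancel₀ hg (by rw [he, one_mul])
  rw [this, map_one]

/-- Jacobian criterion: a hypersurface `g = 0` such that some vector field is transverse to it
is smooth. -/
lemma formallySmooth_quotient_of_derivation {k P : Type*} [CommRing k] [CommRing P] [Algebra k P]
    [Algebra.FormallySmooth k P] {g : P} (D : Derivation k P P)
    (hD : D g - 1 ∈ Ideal.span {g}) : Algebra.FormallySmooth k (P ⧸ Ideal.span {g}) := by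
  obtain ⟨c, hc⟩ := Ideal.mem_span_singleton.1 hD
  refine Algebra.FormallySmooth.of_comp_surjective fun B _ _ J hJ φ => ?_
  obtain ⟨ρ, hρ⟩ := Algebra.FormallySmooth.comp_surjective k P J hJ
    (φ.comp (Ideal.Quotient.mkₐ k (Ideal.span {g})))
  have hρ' : ∀ p, Ideal.Quotient.mk J (ρ p) = φ (Ideal.Quotient.mk _ p) :=
    fun p => AlgHom.congr_fun hρ p
  have hεJ : -ρ g ∈ J := by
    rw [← Ideal.Quotient.eq_zero_iff_mem, map_neg, hρ',
      Ideal.Quotient.eq_zero_iff_mem.2 (Ideal.mem_span_singleton_self g), map_zero, neg_zero]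
  have hε : -ρ g * -ρ g = 0 := by
    have := Ideal.mul_mem_mul hεJ hεJ
    rwa [← pow_two, hJ, Ideal.mem_bot] at this
  -- With ε = −ρ(g), the deformed value ρ(g) + ερ(D g) is a multiple of ε² because D g ≡ 1 mod g.
  have hzero : deform ρ D (-ρ g) hε g = 0 := by
    have h1 : D g = 1 + g * c := by rw [← hc]; ring
    rw [deform_apply, h1, map_add, map_one, map_mul]
    linear_combination (-ρ c) * hε
  refine ⟨Ideal.Quotient.liftₐ _ (deform ρ D (-ρ g) hε) (fun a ha => ?_), ?_⟩
  · obtain ⟨b, rfl⟩ := Ideal.mem_span_singleton.1 ha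
    rw [map_mul, hzero, zero_mul]
  · ext p
    obtain ⟨p, rfl⟩ := Ideal.Quotient.mk_surjective p
    change Ideal.Quotient.mk J (deform ρ D (-ρ g) hε p) = _
    rw [deform_apply, map_add, hρ', map_mul, Ideal.Quotient.eq_zero_iff_mem.2 hεJ, zero_mul,
      add_zero]

/-- The suspension over a smooth variety is smooth if some vector field on the base is transverse
to `f = 0`. -/
lemma Susp.formallySmooth {k R : Type*} [CommRing k] [CommRing R] [Algebra k R]
    [Algebra.FormallySmooth k R] {f : R} (D : Derivation k R R)
    (hD : D f - 1 ∈ Ideal.span {f}) : Algebra.FormallySmooth k (Susp f) := by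
  obtain ⟨c, hc⟩ := Ideal.mem_span_singleton.1 hD
  refine Algebra.FormallySmooth.of_comp_surjective fun B _ _ J hJ φ => ?_
  obtain ⟨ρ, hρ⟩ := Algebra.FormallySmooth.comp_surjective k R J hJ (φ.comp (Susp.incl f k))
  have hρ' : ∀ r, Ideal.Quotient.mk J (ρ r) = φ (algebraMap R (Susp f) r) :=
    fun r => AlgHom.congr_fun hρ r
  obtain ⟨a, ha⟩ := Ideal.Quotient.mk_surjective (φ (Susp.u f))
  obtain ⟨b, hb⟩ := Ideal.Quotient.mk_surjective (φ (Susp.v f))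
  have hεJ : a * b - ρ f ∈ J := by
    rw [← Ideal.Quotient.eq_zero_iff_mem, map_sub, map_mul, ha, hb, hρ', ← map_mul,
      Susp.u_mul_v, sub_self]
  obtain ⟨ε, hε0⟩ : ∃ ε, ε = a * b - ρ f := ⟨_, rfl⟩
  rw [← hε0] at hεJ
  have hε : ε * ε = 0 := by
    have := Ideal.mul_mem_mul hεJ hεJ
    rwa [← pow_two, hJ, Ideal.mem_bot] at this
  have hεq : Ideal.Quotient.mk J ε = 0 := Ideal.Quotient.eq_zero_iff_mem.2 hεJ
  have h1 : ρ (D f) = 1 + ρ f * ρ c := by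
    rw [← map_one ρ, ← map_mul, ← map_add, ← hc]; ring_nf
  -- Deforming ρ along D absorbs the defect ε = ab − ρ(f) up to ερ(f)ρ(c). Modulo ε² this equals
  -- εabρ(c), which dictates the correction of b.
  have hlift : a * (b + ε * b * ρ c) = deform ρ D ε hε f := by
    rw [deform_apply, h1]
    linear_combination (-(1 + ε * ρ c)) * hε0 + ρ c * hε
  refine ⟨Susp.lift (deform ρ D ε hε) a (b + ε * b * ρ c) hlift, Susp.algHom_ext ?_ ?_ ?_⟩
  · intro r
    change Ideal.Quotient.mk J (Susp.lift _ _ _ hlift (algebraMap R (Susp f) r)) = _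
    rw [Susp.lift_algebraMap, deform_apply, map_add, hρ', map_mul, hεq, zero_mul, add_zero]
  · change Ideal.Quotient.mk J (Susp.lift _ _ _ hlift (Susp.u f)) = _
    rw [Susp.lift_u, ha]
  · change Ideal.Quotient.mk J (Susp.lift _ _ _ hlift (Susp.v f)) = _
    rw [Susp.lift_v, map_add, map_mul, map_mul, hεq, hb, zero_mul, zero_mul, add_zero]

/-- Restriction of the suspension to `u = v = 0`. -/
def Susp.modUV (k : Type*) {R : Type*} [CommRing k] [CommRing R] [Algebra k R] (f : R) :
    Susp f →ₐ[k] R ⧸ Ideal.span {f} :=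
  Susp.lift (Ideal.Quotient.mkₐ k (Ideal.span {f})) 0 0 (by
    rw [zero_mul, Ideal.Quotient.mkₐ_eq_mk,
      Ideal.Quotient.eq_zero_iff_mem.2 (Ideal.mem_span_singleton_self f)])

/-- The Jacobian criterion in `R[X₀, X₁]` gives E with E(X₀X₁ − f) = 1. On u = v = 0 the term
E(X₀X₁) vanishes, so −E restricted to `R` takes f to 1 modulo f; smoothness of `R` lifts it to a
vector field. -/
lemma Susp.exists_derivation {k R : Type*} [CommRing k] [CommRing R] [IsDomain R] [Algebra k R]
    [Algebra.FormallySmooth k R] {f : R} (hf : f ≠ 0) [Algebra.FormallySmooth k (Susp f)] :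
    ∃ D : Derivation k R R, D f - 1 ∈ Ideal.span {f} := by
  have hg : (MvPolynomial.X 0 * MvPolynomial.X 1 - MvPolynomial.C f :
      MvPolynomial (Fin 2) R) ≠ 0 := by
    intro h
    have := congrArg (MvPolynomial.eval (0 : Fin 2 → R)) h
    simp [hf] at this
  have : Algebra.FormallySmooth k (MvPolynomial (Fin 2) R) :=
    Algebra.FormallySmooth.comp k R _
  obtain ⟨E, hE⟩ := exists_derivation_eq_one (k := k) hg
  let δ : Derivation k R (R ⧸ Ideal.span {f}) := Derivation.mk'
    (-((Susp.modUV k f).toLinearMap ∘ₗ E.toLinearMap ∘ₗ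
      (IsScalarTower.toAlgHom k R (MvPolynomial (Fin 2) R)).toLinearMap)) (by
      intro a b
      have hC : ∀ r : R, Ideal.Quotient.mk (Ideal.span {f}) r =
          Susp.modUV k f (Ideal.Quotient.mk _ (MvPolynomial.C r)) := fun r =>
        by
          rw [Susp.mk_C]
          exact (Susp.lift_algebraMap (Ideal.Quotient.mkₐ k (Ideal.span {f})) 0 0 _ r).symm
      have hs : ∀ (r : R) (z : Susp f),
          Susp.modUV k f ((MvPolynomial.C r : MvPolynomial (Fin 2) R) • z) =
            r • Susp.modUV k f z := by
        intro r z
        change Susp.modUV k f (Ideal.Quotient.mk _ (MvPolynomial.C r) * z) =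
          Ideal.Quotient.mk _ r * Susp.modUV k f z
        rw [map_mul, hC]
      simp only [LinearMap.neg_apply, LinearMap.comp_apply, AlgHom.toLinearMap_apply,
        IsScalarTower.coe_toAlgHom', Derivation.coeFn_coe,
        MvPolynomial.algebraMap_eq, map_mul, Derivation.leibniz, map_add, hs, smul_neg]
      ring)
  have hδ : δ f = 1 := by
    have h1 : E (MvPolynomial.C f) =
        (MvPolynomial.X 0 : MvPolynomial (Fin 2) R) • E (MvPolynomial.X 1) +
          (MvPolynomial.X 1 : MvPolynomial (Fin 2) R) • E (MvPolynomial.X 0) - 1 := by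
      rw [← hE, map_sub, Derivation.leibniz]; abel
    have hu : Susp.modUV k f (Susp.u f) = 0 := Susp.lift_u ..
    have hv : Susp.modUV k f (Susp.v f) = 0 := Susp.lift_v ..
    change -(Susp.modUV k f (E (MvPolynomial.C f))) = 1
    rw [h1, Algebra.smul_def, Algebra.smul_def]
    change -(Susp.modUV k f (Susp.u f * _ + Susp.v f * _ - 1)) = 1
    rw [map_sub, map_add, map_mul, map_mul, hu, hv, map_one]
    simp
  obtain ⟨D, hD⟩ := exists_derivation_lift δ
  refine ⟨D, ?_⟩
  rw [← Ideal.Quotient.eq_zero_iff_mem, map_sub, hD, hδ, map_one, sub_self]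

/-- The base of a smooth suspension is smooth. -/
lemma Susp.formallySmooth_base {k R : Type*} [CommRing k] [CommRing R] [IsDomain R] [Algebra k R]
    {f : R} (hf : f ≠ 0) [Algebra.FormallySmooth k (Susp f)] : Algebra.FormallySmooth k R := by
  let := (Susp.toLaurent f).toRingHom.toAlgebra
  have := Susp.isLocalization hf
  have : IsScalarTower k (Susp f) (LaurentPolynomial R) := IsScalarTower.of_algebraMap_eq (by
    intro c
    change _ = Susp.toLaurent f (algebraMap k (Susp f) c)
    rw [IsScalarTower.algebraMap_apply k R (Susp f), AlgHom.commutes]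
    rfl)
  have : Algebra.FormallySmooth (Susp f) (LaurentPolynomial R) :=
    Algebra.FormallySmooth.of_isLocalization (Submonoid.powers (Susp.u f))
  have : Algebra.FormallySmooth k (LaurentPolynomial R) := Algebra.FormallySmooth.comp k (Susp f) _
  -- Setting T = 1 retracts the Laurent ring onto `R`.
  let r : LaurentPolynomial R →+* R := LaurentPolynomial.eval₂ (RingHom.id R) 1
  have hr : ∀ a, r (LaurentPolynomial.C a) = a := fun a => by simp [r]
  refine formallySmooth_of_retract (B := LaurentPolynomial R)
    (IsScalarTower.toAlgHom k R (LaurentPolynomial R))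
    { r with commutes' := fun c => hr (algebraMap k R c) } ?_
  ext a
  exact hr a

end Smoothness

/-! ### Lifting actions to the suspension and its flexibility -/

section Lifting

variable {K R : Type*} [Field K] [CommRing R] [Algebra K R]

/-- Substituting points of an arbitrary domain into the comorphism, a `𝔾ₐ`-action still satisfies
the axiom of an action. -/
lemma GaAction.eval₂_add {B : Type*} [CommRing B] [IsDomain B] [Algebra K B] [Infinite K]
    (φ : GaAction K R) (ι : R →ₐ[K] B) (ψ : B → R →ₐ[K] B)
    (hψ : ∀ q a, ψ q a = (φ.comorphism a).eval₂ (ι : R →+* B) q) (p q : B) (a : R) :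
    (φ.comorphism a).eval₂ (ι : R →+* B) (p + q) =
      (φ.comorphism a).eval₂ (ψ q : R →+* B) p := by
  have hinf : (Set.range (algebraMap K B)).Infinite :=
    Set.infinite_range_of_injective (algebraMap K B).injective
  have heval : ∀ (g : R →ₐ[K] B) (s : K) (b : R),
      (φ.comorphism b).eval₂ (g : R →+* B) (algebraMap K B s) = g (φ.act s b) := by
    intro g s b
    rw [GaAction.act_apply]
    have := Polynomial.hom_eval₂ (φ.comorphism b) (RingHom.id R) (g : R →+* B) (algebraMap K R s)
    simpa [Polynomial.eval₂_id] using this.symm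
  -- The action axiom is known only for scalar times. Both sides are polynomial in each time and `K`
  -- is infinite in the domain `B`, so each time is freed in turn: here q, afterwards p.
  have hscalar : ∀ (s : K) (q : B),
      (φ.comorphism a).eval₂ (ι : R →+* B) (algebraMap K B s + q) =
        (φ.comorphism a).eval₂ (ψ q : R →+* B) (algebraMap K B s) := by
    intro s q
    rw [heval, hψ]
    have hpoly : ((φ.comorphism a).map (ι : R →+* B)).comp (X + C (algebraMap K B s)) =
        (φ.comorphism (φ.act s a)).map (ι : R →+* B) := by
      apply Polynomial.eq_of_infinite_eval_eq
      refine hinf.mono ?_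
      rintro _ ⟨t, rfl⟩
      change eval _ _ = eval _ _
      rw [Polynomial.eval_comp, Polynomial.eval_map, Polynomial.eval_map, heval, eval_add, eval_X,
        eval_C, ← map_add, heval, add_comm, GaAction.act_add]
    have := congrArg (Polynomial.eval q) hpoly
    rw [Polynomial.eval_comp, Polynomial.eval_map, Polynomial.eval_map, eval_add, eval_X,
      eval_C, add_comm] at this
    exact this
  have hpoly : ((φ.comorphism a).map (ι : R →+* B)).comp (X + C q) =
      (φ.comorphism a).map (ψ q : R →+* B) := by
    apply Polynomial.eq_of_infinite_eval_eq
    refine hinf.mono ?_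
    rintro _ ⟨t, rfl⟩
    change eval _ _ = eval _ _
    rw [Polynomial.eval_comp, Polynomial.eval_map, Polynomial.eval_map, eval_add, eval_X,
      eval_C, hscalar]
  have := congrArg (Polynomial.eval p) hpoly
  rwa [Polynomial.eval_comp, Polynomial.eval_map, Polynomial.eval_map, eval_add, eval_X,
    eval_C] at this

lemma eval₂_eq_mul_divX {A B : Type*} [CommRing A] [CommRing B] (g : A →+* B) (b : B)
    (p : A[X]) : p.eval₂ g b = b * p.divX.eval₂ g b + g (p.coeff 0) := by
  conv_lhs => rw [← Polynomial.X_mul_divX_add p]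
  rw [Polynomial.eval₂_add, Polynomial.eval₂_mul, Polynomial.eval₂_X, Polynomial.eval₂_C]

namespace Susp

/-- Substitution of a `K`-algebra-valued point for the parameter of a `𝔾ₐ`-action. -/
def paramHom {B : Type*} [CommRing B] [Algebra K B] (φ : GaAction K R) (ι : R →ₐ[K] B) (q : B) :
    R →ₐ[K] B :=
  (Polynomial.eval₂AlgHom ι q (fun _ => Commute.all _ _)).comp φ.comorphism

lemma paramHom_apply {B : Type*} [CommRing B] [Algebra K B] (φ : GaAction K R) (ι : R →ₐ[K] B)
    (q : B) (a : R) : paramHom φ ι q a = (φ.comorphism a).eval₂ (ι : R →+* B) q := rfl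

variable (f : R)

/-- Comorphism of the lift of a `𝔾ₐ`-action to the suspension: `u` is invariant and the parameter
is multiplied by `u`. -/
def liftComorphism (φ : GaAction K R) : Susp f →ₐ[K] (Susp f)[X] :=
  lift (paramHom φ ((Algebra.ofId (Susp f) (Susp f)[X]).restrictScalars K |>.comp (incl f K))
      (C (u f) * X))
    (C (u f))
    -- The value f at time ut is f + ut·g(ut), with g the `divX`; dividing by u turns v into v +
    -- t·g(ut).
    (C (v f) + X * ((φ.comorphism f).divX.eval₂ (C.comp (algebraMap R (Susp f))) (C (u f) * X)))
    (by
      rw [paramHom_apply]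
      nth_rw 2 [← Polynomial.X_mul_divX_add (φ.comorphism f)]
      rw [Polynomial.eval₂_add, Polynomial.eval₂_mul, Polynomial.eval₂_X, Polynomial.eval₂_C,
        φ.coeff_zero_comorphism, mul_add, ← C_mul, u_mul_v]
      change C (algebraMap R (Susp f) f) + C (u f) * (X * eval₂ _ _ _) =
        C (u f) * X * eval₂ (C.comp (algebraMap R (Susp f))) _ _ + C (algebraMap R (Susp f) f)
      ring)

variable {f}

lemma liftComorphism_algebraMap (φ : GaAction K R) (r : R) :
    liftComorphism f φ (algebraMap R (Susp f) r) =
      (φ.comorphism r).eval₂ (C.comp (algebraMap R (Susp f))) (C (u f) * X) :=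
  lift_algebraMap ..

lemma liftComorphism_u (φ : GaAction K R) : liftComorphism f φ (u f) = C (u f) := lift_u ..

lemma liftComorphism_v (φ : GaAction K R) : liftComorphism f φ (v f) = C (v f) + X *
    ((φ.comorphism f).divX.eval₂ (C.comp (algebraMap R (Susp f))) (C (u f) * X)) := lift_v ..

lemma eval_eval₂_C_comp (p : R[X]) (c : Susp f) :
    (p.eval₂ (C.comp (algebraMap R (Susp f))) (C (u f) * X)).eval c =
      p.eval₂ (algebraMap R (Susp f)) (u f * c) := by
  have h := Polynomial.hom_eval₂ p (C.comp (algebraMap R (Susp f)))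
    (Polynomial.evalRingHom c) (C (u f) * X)
  rw [Polynomial.coe_evalRingHom] at h
  rw [h]
  congr 1
  · ext r; simp
  · simp

/-- Tangent vectors to the suspension off `u = 0` are determined by their `u`-component and their
projection to the base. -/
lemma tangent_ext {x : Susp f →ₐ[K] K} (hx : x (u f) ≠ 0) {D E : Susp f →ₗ[K] K}
    (hD : D ∈ tangentSpace x) (hE : E ∈ tangentSpace x) (hu : D (u f) = E (u f))
    (hr : ∀ r, D (algebraMap R (Susp f) r) = E (algebraMap R (Susp f) r)) : D = E := by
  have hv : D (v f) = E (v f) := by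
    have h1 := hD (u f) (v f)
    have h2 := hE (u f) (v f)
    rw [u_mul_v] at h1 h2
    rw [hr, h2, hu] at h1
    have h3 : x (u f) * D (v f) = x (u f) * E (v f) := by linear_combination -h1
    exact mul_left_cancel₀ hx h3
  refine LinearMap.ext fun s => ?_
  induction s using induction_on with
  | base r => exact hr r
  | add s t hs ht => rw [map_add, map_add, hs, ht]
  | mul_u s hs => rw [hD, hE, hs, hu]
  | mul_v s hs => rw [hD, hE, hs, hv]

section Domain

variable [IsDomain R] [Infinite K]

/-- The lift of a `𝔾ₐ`-action on the base to the suspension. -/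
def liftAction (hf : f ≠ 0) (φ : GaAction K R) : GaAction K (Susp f) where
  comorphism := liftComorphism f φ
  zero_act := by
    have h : (evalScalar K (Susp f) 0).comp (liftComorphism f φ) = AlgHom.id K (Susp f) := by
      refine algHom_ext (fun r => ?_) ?_ ?_
      · rw [AlgHom.comp_apply, liftComorphism_algebraMap, evalScalar_apply, map_zero,
          eval_eval₂_C_comp, mul_zero, Polynomial.eval₂_at_zero, φ.coeff_zero_comorphism]
        rfl
      · simp [liftComorphism_u]
      · simp [liftComorphism_v]
    intro a
    have := AlgHom.congr_fun h a
    simpa using this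
  add_act := by
    have := isDomain hf
    intro s t
    let A : K → (Susp f →ₐ[K] Susp f) := fun s =>
      (evalScalar K (Susp f) s).comp (liftComorphism f φ)
    have hAu : ∀ s, A s (u f) = u f := fun s => by simp [A, liftComorphism_u]
    have hAr : ∀ s r, A s (algebraMap R (Susp f) r) =
        (φ.comorphism r).eval₂ (algebraMap R (Susp f)) (u f * algebraMap K (Susp f) s) := by
      intro s r
      simp only [A, AlgHom.comp_apply, liftComorphism_algebraMap, evalScalar_apply,
        eval_eval₂_C_comp]
    have hr : ∀ r, A (s + t) (algebraMap R (Susp f) r) = A t (A s (algebraMap R (Susp f) r)) := by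
      intro r
      have h1 := Polynomial.hom_eval₂ (φ.comorphism r) (algebraMap R (Susp f))
        (A t : Susp f →+* Susp f) (u f * algebraMap K (Susp f) s)
      have h2 := φ.eval₂_add (incl f K) (paramHom φ (incl f K)) (paramHom_apply φ (incl f K))
        (u f * algebraMap K (Susp f) s) (u f * algebraMap K (Susp f) t) r
      rw [hAr, hAr, map_add, mul_add]
      refine Eq.trans h2 (Eq.trans ?_ h1.symm)
      congr 1
      · ext a
        exact (hAr t a).symm
      · simp [hAu]
    have h : A (s + t) = (A t).comp (A s) := by
      refine algHom_ext hr ?_ ?_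
      · simp [hAu]
      -- In the domain `Susp f`, the image of v is determined by those of u and f = uv.
      · refine mul_left_cancel₀ (u_ne_zero (f := f)) ?_
        have e1 : u f * A (s + t) (v f) = A (s + t) (algebraMap R (Susp f) f) := by
          rw [← u_mul_v, map_mul, hAu]
        have e2 : u f * (A t).comp (A s) (v f) = A t (A s (algebraMap R (Susp f) f)) := by
          rw [← u_mul_v, map_mul, map_mul, hAu, hAu, AlgHom.comp_apply]
        rw [e1, e2, hr]
    intro a
    have := AlgHom.congr_fun h a
    simpa only [A, AlgHom.comp_apply, evalScalar_apply] using this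

variable (hf : f ≠ 0) (φ : GaAction K R)

lemma liftAction_derivation_u : (liftAction hf φ).derivation (u f) = 0 := by
  rw [GaAction.derivation_apply]
  change (liftComorphism f φ (u f)).coeff 1 = 0
  rw [liftComorphism_u, Polynomial.coeff_C_of_ne_zero one_ne_zero]

lemma liftAction_derivation_v :
    (liftAction hf φ).derivation (v f) = algebraMap R (Susp f) (φ.derivation f) := by
  rw [GaAction.derivation_apply]
  change (liftComorphism f φ (v f)).coeff 1 = _
  rw [liftComorphism_v, Polynomial.coeff_add, Polynomial.coeff_C_of_ne_zero one_ne_zero, zero_add,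
    Polynomial.coeff_X_mul, Polynomial.coeff_zero_eq_eval_zero, eval_eval₂_C_comp, mul_zero,
    Polynomial.eval₂_at_zero, Polynomial.coeff_divX, GaAction.derivation_apply]

lemma liftAction_derivation_algebraMap (r : R) :
    (liftAction hf φ).derivation (algebraMap R (Susp f) r) =
      u f * algebraMap R (Susp f) (φ.derivation r) := by
  rw [GaAction.derivation_apply]
  change (liftComorphism f φ (algebraMap R (Susp f) r)).coeff 1 = _
  rw [liftComorphism_algebraMap, GaAction.derivation_apply]
  refine (congrArg (fun p : (Susp f)[X] => p.coeff 1) (eval₂_eq_mul_divX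
    (C.comp (algebraMap R (Susp f))) (C (u f) * X) (φ.comorphism r))).trans ?_
  change (_ + C (algebraMap R (Susp f) ((φ.comorphism r).coeff 0))).coeff 1 = _
  rw [Polynomial.coeff_add, Polynomial.coeff_C_of_ne_zero one_ne_zero, add_zero,
    mul_assoc, Polynomial.coeff_C_mul, Polynomial.coeff_X_mul,
    Polynomial.coeff_zero_eq_eval_zero, eval_eval₂_C_comp, mul_zero,
    Polynomial.eval₂_at_zero, Polynomial.coeff_divX]

lemma liftAction_act_u (s : K) : (liftAction hf φ).act s (u f) = u f := by
  rw [GaAction.act_apply]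
  change (liftComorphism f φ (u f)).eval _ = _
  rw [liftComorphism_u, eval_C]

lemma liftAction_act_v (s : K) : (liftAction hf φ).act s (v f) =
    v f + algebraMap K (Susp f) s *
      (φ.comorphism f).divX.eval₂ (algebraMap R (Susp f)) (u f * algebraMap K (Susp f) s) := by
  rw [GaAction.act_apply]
  change (liftComorphism f φ (v f)).eval _ = _
  rw [liftComorphism_v, eval_add, eval_C, eval_mul, eval_X, eval_eval₂_C_comp]

lemma liftAction_act_algebraMap (s : K) (r : R) :
    (liftAction hf φ).act s (algebraMap R (Susp f) r) =
      (φ.comorphism r).eval₂ (algebraMap R (Susp f)) (u f * algebraMap K (Susp f) s) := by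
  rw [GaAction.act_apply]
  change (liftComorphism f φ (algebraMap R (Susp f) r)).eval _ = _
  rw [liftComorphism_algebraMap, eval_eval₂_C_comp]

/-- Orbits on the base lift to the suspension off `u = 0`. -/
lemma exists_reach_lift (hf : f ≠ 0) {x : Susp f →ₐ[K] K} (hx : x (u f) ≠ 0) {z : R →ₐ[K] K}
    (hz : Reach (x.comp (incl f K)) z) :
    ∃ x' : Susp f →ₐ[K] K, Reach x x' ∧ x' (u f) ≠ 0 ∧ x'.comp (incl f K) = z := by
  induction hz with
  | refl => exact ⟨x, Relation.ReflTransGen.refl, hx, rfl⟩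
  | tail _ hstep ih =>
    obtain ⟨x', hr, hu, rfl⟩ := ih
    obtain ⟨φ, s, rfl⟩ := hstep
    -- The lifted action runs u times as fast on the base, hence the time s/u.
    refine ⟨x'.comp ((liftAction hf φ).act (s / x' (u f))), hr.tail ⟨_, _, rfl⟩, ?_, ?_⟩
    · rwa [AlgHom.comp_apply, liftAction_act_u]
    · ext r
      simp only [AlgHom.comp_apply, incl_apply, liftAction_act_algebraMap]
      have h1 := Polynomial.hom_eval₂ (φ.comorphism r) (algebraMap R (Susp f))
        (x' : Susp f →+* K) (u f * algebraMap K (Susp f) (s / x' (u f)))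
      have h2 := Polynomial.hom_eval₂ (φ.comorphism r) (RingHom.id R)
        ((x' : Susp f →+* K).comp (algebraMap R (Susp f))) (algebraMap K R s)
      rw [Polynomial.eval₂_id, ← GaAction.act_apply, RingHom.comp_id] at h2
      refine h1.trans (Eq.trans ?_ h2.symm)
      congr 1
      simp only [RingHom.comp_apply, RingHom.coe_coe, map_mul, AlgHom.commutes,
        Algebra.algebraMap_self, RingHom.id_apply]
      rw [← IsScalarTower.algebraMap_apply, AlgHom.commutes, Algebra.algebraMap_self,
        RingHom.id_apply]
      field_simp

/-- Lifted velocities divided by u realize all base directions with zero u-component, and the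
exchanged lift of φ supplies a vector with nonzero u-component ∂f. By `tangent_ext` nothing else is
needed. -/
lemma isFlexiblePoint_of_derivation_ne_zero (hf : f ≠ 0) {x : Susp f →ₐ[K] K} (hx : x (u f) ≠ 0)
    (hy : IsFlexiblePoint (x.comp (incl f K)))
    (hφ : ∃ φ : GaAction K R, x (algebraMap R (Susp f) (φ.derivation f)) ≠ 0) :
    IsFlexiblePoint x := by
  apply le_antisymm
  · rw [Submodule.span_le]
    rintro _ ⟨φ, rfl⟩
    exact φ.velocity_mem_tangentSpace _
  · intro D hD
    set V := Submodule.span K (Set.range fun φ : GaAction K (Susp f) => φ.velocity x) with hV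
    have hVT : V ≤ tangentSpace x := by
      rw [hV, Submodule.span_le]
      rintro _ ⟨φ, rfl⟩
      exact φ.velocity_mem_tangentSpace _
    obtain ⟨φ, hφ⟩ := hφ
    let E : Susp f →ₗ[K] K := ((liftAction hf φ).conj (swap f K)).velocity x
    have hE : E ∈ V := Submodule.subset_span ⟨_, rfl⟩
    have hEu : E (u f) = x (algebraMap R (Susp f) (φ.derivation f)) := by
      simp only [E, GaAction.velocity_apply, GaAction.conj_derivation, swap_symm, swap_u,
        liftAction_derivation_v, swap_algebraMap]
    have hlift : ∀ w ∈ tangentSpace (x.comp (incl f K)), ∃ W ∈ V, W (u f) = 0 ∧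
        ∀ r, W (algebraMap R (Susp f) r) = w r := by
      intro w hw
      rw [← hy] at hw
      induction hw using Submodule.span_induction with
      | mem w hw =>
        obtain ⟨ψ, rfl⟩ := hw
        refine ⟨(x (u f))⁻¹ • (liftAction hf ψ).velocity x,
          Submodule.smul_mem _ _ (Submodule.subset_span ⟨_, rfl⟩), ?_, fun r => ?_⟩
        · simp [GaAction.velocity_apply, liftAction_derivation_u]
        · simp [GaAction.velocity_apply, liftAction_derivation_algebraMap, hx]
      | zero => exact ⟨0, zero_mem _, by simp, by simp⟩
      | add w z _ _ h1 h2 =>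
        obtain ⟨W, hW, h, h'⟩ := h1
        obtain ⟨Z, hZ, k, k'⟩ := h2
        exact ⟨W + Z, add_mem hW hZ, by simp [h, k], by simp [h', k']⟩
      | smul c w _ h1 =>
        obtain ⟨W, hW, h, h'⟩ := h1
        exact ⟨c • W, Submodule.smul_mem _ _ hW, by simp [h], by simp [h']⟩
    have hmem : D - (D (u f) / E (u f)) • E ∈ tangentSpace x :=
      sub_mem hD (Submodule.smul_mem _ _ (hVT hE))
    obtain ⟨W, hW, hWu, hWr⟩ := hlift
      ((D - (D (u f) / E (u f)) • E) ∘ₗ (incl f K).toLinearMap) (by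
        intro a b
        have := hmem (algebraMap R (Susp f) a) (algebraMap R (Susp f) b)
        rw [← map_mul] at this
        exact this)
    have hEu' : E (u f) ≠ 0 := by rwa [hEu]
    have heq : D - (D (u f) / E (u f)) • E = W := by
      refine tangent_ext hx hmem (hVT hW) ?_ fun r => (hWr r).symm
      rw [hWu]
      simp [hEu']
    rw [← sub_add_cancel D ((D (u f) / E (u f)) • E), heq]
    exact add_mem hW (Submodule.smul_mem _ _ hE)

end Domain

variable [IsDomain R] [CharZero K] [IsNoetherianRing R]

/-- Move along the base to a point where some generator does not kill f, lift the path to the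
suspension keeping u nonzero, and carry flexibility back along it. -/
lemma isFlexiblePoint_of_u_ne_zero (hf : ∀ c : K, f ≠ algebraMap K R c)
    (hR : ∀ y : R →ₐ[K] K, IsFlexiblePoint y) {x : Susp f →ₐ[K] K} (hx : x (u f) ≠ 0) :
    IsFlexiblePoint x := by
  have hf0 : f ≠ 0 := by simpa using hf 0
  obtain ⟨z, hz, φ, hφ⟩ := exists_reach_derivation_ne_zero (hR (x.comp (incl f K))) hf
  obtain ⟨x', hr, hu, rfl⟩ := exists_reach_lift hf0 hx hz
  exact hr.isFlexiblePoint (isFlexiblePoint_of_derivation_ne_zero hf0 hu (hR _) ⟨φ, hφ⟩)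

lemma isFlexiblePoint_of_v_ne_zero (hf : ∀ c : K, f ≠ algebraMap K R c)
    (hR : ∀ y : R →ₐ[K] K, IsFlexiblePoint y) {x : Susp f →ₐ[K] K} (hx : x (v f) ≠ 0) :
    IsFlexiblePoint x := by
  have h := (isFlexiblePoint_of_u_ne_zero hf hR
    (x := x.comp (swap f K : Susp f →ₐ[K] Susp f)) (by simpa using hx)).comp_equiv (swap f K)
  convert h using 1
  refine algHom_ext (fun r => ?_) ?_ ?_ <;> simp

/-- The suspension is flexible at every point if some vector field on the flexible base is
transverse to `f = 0`. -/
theorem isFlexiblePoint (hf : ∀ c : K, f ≠ algebraMap K R c)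
    (hR : ∀ y : R →ₐ[K] K, IsFlexiblePoint y) (D : Derivation K R R)
    (hD : D f - 1 ∈ Ideal.span {f}) (x : Susp f →ₐ[K] K) : IsFlexiblePoint x := by
  have hf0 : f ≠ 0 := by simpa using hf 0
  by_cases hu : x (u f) = 0
  swap
  · exact isFlexiblePoint_of_u_ne_zero hf hR hu
  by_cases hv : x (v f) = 0
  swap
  · exact isFlexiblePoint_of_v_ne_zero hf hR hv
  set y : R →ₐ[K] K := x.comp (incl f K) with hy
  have hyf : y f = 0 := by
    rw [hy, AlgHom.comp_apply, incl_apply, ← u_mul_v, map_mul, hu, zero_mul]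
  have hyD : y (D f) = 1 := by
    obtain ⟨c, hc⟩ := Ideal.mem_span_singleton.1 hD
    rw [sub_eq_iff_eq_add] at hc
    rw [hc, map_add, map_mul, hyf, zero_mul, zero_add, map_one]
  -- D induces a tangent vector at `y` taking f to 1. It is a combination of orbit velocities, so
  -- one of them is nonzero on f.
  have hφ : ∃ φ : GaAction K R, y (φ.derivation f) ≠ 0 := by
    by_contra! h
    have hT : y.toLinearMap ∘ₗ D.toLinearMap ∈ tangentSpace y := by
      intro a b
      simp
    rw [← hR y] at hT
    have hle : Submodule.span K (Set.range fun φ : GaAction K R => φ.velocity y) ≤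
        LinearMap.ker (LinearMap.applyₗ f) := by
      rw [Submodule.span_le]
      rintro _ ⟨φ, rfl⟩
      change φ.velocity y f = 0
      rw [GaAction.velocity_apply, h]
    have h0 : y (D f) = 0 := hle hT
    rw [hyD] at h0
    exact one_ne_zero h0
  obtain ⟨φ, hφ⟩ := hφ
  -- At u = v = 0 the lifted action moves v linearly in time, with speed ∂f(y) ≠ 0.
  have hv' : (x.comp ((liftAction hf0 φ).act 1)) (v f) ≠ 0 := by
    rw [AlgHom.comp_apply, liftAction_act_v, map_add, hv, zero_add, map_one, one_mul, mul_one]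
    have h1 := Polynomial.hom_eval₂ (φ.comorphism f).divX (algebraMap R (Susp f))
      (x : Susp f →+* K) (u f)
    rw [RingHom.coe_coe, hu, Polynomial.eval₂_at_zero, Polynomial.coeff_divX] at h1
    rw [h1]
    exact hφ
  exact Reach.isFlexiblePoint (Relation.ReflTransGen.single ⟨_, _, rfl⟩)
    (isFlexiblePoint_of_v_ne_zero hf hR hv')

end Susp

end Lifting

/-! ### Existence of points and assembly of the equivalence -/

/-- Over an algebraically closed field, a nonempty affine variety has a point. -/
lemma exists_point (K R : Type*) [Field K] [IsAlgClosed K] [CommRing R] [Algebra K R]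
    [Algebra.FiniteType K R] [Nontrivial R] : Nonempty (R →ₐ[K] K) := by
  obtain ⟨m, hm⟩ := Ideal.exists_maximal R
  let := Ideal.Quotient.field m
  have : Algebra.FiniteType K (R ⧸ m) := inferInstance
  have : Module.Finite K (R ⧸ m) := finite_of_finite_type_of_isJacobsonRing K (R ⧸ m)
  let e : K ≃ₐ[K] (R ⧸ m) := AlgEquiv.ofBijective (Algebra.ofId K (R ⧸ m))
    IsAlgClosed.algebraMap_bijective_of_isIntegral
  exact ⟨(e.symm : (R ⧸ m) →ₐ[K] K).comp (Ideal.Quotient.mkₐ K m)⟩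

lemma isSmoothPoint_of_smooth {K A : Type*} [Field K] [CommRing A] [Algebra K A]
    [Algebra.Smooth K A] (x : A →ₐ[K] K) : IsSmoothPoint x := by
  unfold IsSmoothPoint
  rw [Algebra.smoothLocus_eq_univ]
  trivial

lemma smooth_of_formallySmooth {K A : Type*} [Field K] [CommRing A] [Algebra K A]
    [Algebra.FiniteType K A] (h : Algebra.FormallySmooth K A) : Algebra.Smooth K A :=
  ⟨h, Algebra.FinitePresentation.of_finiteType.1 inferInstance⟩

/-- The zero set of a prime element has the expected coordinate ring. -/
def zeroSetEquiv {K R : Type*} [Field K] [CommRing R] [Algebra K R] {f : R} (hf : Prime f) :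
    ZeroSet f ≃ₐ[K] R ⧸ Ideal.span {f} :=
  Ideal.quotientEquivAlgOfEq K
    ((Ideal.span_singleton_prime hf.ne_zero).2 hf).isRadical.radical

end AffineFlexibility

end

open AffineFlexibility in
theorem theorem3p1 {K R : Type*} [Field K] [IsAlgClosed K] [CharZero K]
    [CommRing R] [Algebra K R]
    (hY : AffineFlexibility.IsAffineVariety K R)
    (hflex : AffineFlexibility.IsFlexible K R)
    (f : R) (hf : ∀ c : K, f ≠ algebraMap K R c) :
    (AffineFlexibility.IsAffineVariety K (AffineFlexibility.Susp f) ∧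
      Algebra.Smooth K (AffineFlexibility.Susp f) ∧
      AffineFlexibility.IsFlexible K (AffineFlexibility.Susp f) ∧
      AffineFlexibility.IsFactorial (AffineFlexibility.Susp f)) ↔
    (Algebra.Smooth K R ∧
      AffineFlexibility.IsFactorial R ∧
      Prime f ∧
      Algebra.Smooth K (AffineFlexibility.ZeroSet f)) := by
  have : Algebra.FiniteType K R := hY.1
  have : IsNoetherianRing R := Algebra.FiniteType.isNoetherianRing K R
  have hf0 : f ≠ 0 := by simpa using hf 0
  have : Algebra.FiniteType K (Susp f) :=
    Algebra.FiniteType.trans (S := R) inferInstance inferInstance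
  constructor
  · rintro ⟨-, hsm, -, hdom, hufd⟩
    have : IsDomain R := (Susp.algebraMap_injective f).isDomain (algebraMap R (Susp f))
    have hR : Algebra.Smooth K R := smooth_of_formallySmooth (Susp.formallySmooth_base hf0)
    obtain ⟨y⟩ := exists_point K R
    -- A flexible point must exist for this, which is why the Nullstellensatz and the smoothness of
    -- `R` come beforehand.
    have hunit : ¬ IsUnit f :=
      not_isUnit_of_isFlexiblePoint (hflex y (isSmoothPoint_of_smooth y)) hf
    have hu : Prime (Susp.u f) := (Susp.irreducible_u hf0 hunit).prime
    have hprime : Prime f := Susp.prime_of_prime_u hf0 hunit hu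
    obtain ⟨D, hD⟩ := Susp.exists_derivation (k := K) hf0
    have hfs := formallySmooth_quotient_of_derivation D hD
    exact ⟨hR, ⟨inferInstance, (Susp.uniqueFactorizationMonoid_iff hf0 hu).1 hufd⟩, hprime,
      smooth_of_formallySmooth (Algebra.FormallySmooth.of_equiv (zeroSetEquiv hprime).symm)⟩
  · rintro ⟨hR, ⟨hdom, hufd⟩, hprime, hZ⟩
    have : Algebra.FormallySmooth K (R ⧸ Ideal.span {f}) :=
      Algebra.FormallySmooth.of_equiv (zeroSetEquiv hprime)
    obtain ⟨D₀, hD₀⟩ := exists_derivation_eq_one (k := K) hf0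
    obtain ⟨D, hD⟩ := exists_derivation_lift D₀
    have hDf : D f - 1 ∈ Ideal.span {f} := by
      rw [← Ideal.Quotient.eq_zero_iff_mem, map_sub, hD, hD₀, map_one, sub_self]
    have hdomS := Susp.isDomain hf0
    exact ⟨⟨inferInstance, inferInstance⟩, smooth_of_formallySmooth (Susp.formallySmooth D hDf),
      fun x _ => Susp.isFlexiblePoint hf (fun y => hflex y (isSmoothPoint_of_smooth y)) D hDf x,
      hdomS, (Susp.uniqueFactorizationMonoid_iff hf0 (Susp.prime_u hprime)).2 hufd⟩
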